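/- For $x,w$ in the symmetric group $S_n$ let $P_{x,w}=P_{x,w}(v)\in\mathbb{Z}[v]$ denote the Kazhdan--Lusztig polynomial of the pair (for the Coxeter presentation of $S_n$ by the simple transpositions $s_i=(i,i+1)$, normalized so that $P_{w,w}=1$ and $\deg P_{x,w}\le\frac12(\ell(w)-\ell(x)-1)$ for $x<w$ in Bruhat order). Let $\mathrm{coeff}_n$ be the maximum, over all $w\in S_n$, of the largest coefficient of $P_{1,w}$, and let $\mathrm{ev}_n$ be the maximum of $P_{1,w}(1)$ over all $w\in S_n$. For $f,g\colon\mathbb{Z}_{\ge0}\to\mathbb{R}$ write $f\in\Omega(g)$ if there are $C>0$ and $n_0$ with $|f(n)|\ge C\,g(n)$ for all $n>n_0$. For integers $k\ge1$, $l\ge0$ and $n=k+2l$ let $u_l^k\in S_n$ be the permutation with one-line notation $(n-l+1,\dots,n,\,l+1,\dots,n-l,\,1,\dots,l)$, and let $w_l^k=(w_0^l\otimes\mathrm{id}_k\otimes w_0^l)\circ u_l^k$, where $w_0^l\otimes\mathrm{id}_k\otimes w_0^l\in S_n$ reverses the order of the first $l$ letters, fixes the $k$ letters in the middle, and reverses the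 order of the last $l$ letters. Consider, for a given $l$, the statement $$(\ast)_l\qquad P_{1,w_l^k}=(1+v+\dots+v^l)^{k-1}\quad\text{for all }k\ge1 .$$ Theorem. (a) If $(\ast)_l$ holds for all $l\ge0$, then $\mathrm{coeff}_n\in\Omega(\gamma^n)$ and $\mathrm{ev}_n\in\Omega(\gamma^n)$ for every real $\gamma>1$. (b) The statements $(\ast)_0$ and $(\ast)_1$ are true. Moreover (unconditionally) $\mathrm{coeff}_n\in\Omega(n^{-1/2}\cdot2^n)$ and $\mathrm{ev}_n\in\Omega(n^{-1/2}\cdot2^n)$; in particular both sequences grow at least exponentially, that is, each is in $\Omega(\gamma^n)$ for some real $\gamma>1$. -/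

import Mathlib

open scoped LaurentPolynomial

namespace KLGrowth

noncomputable section

/-! ### The symmetric group with its simple transpositions -/

/-- The simple transposition `s_i = (i, i+1)` of the symmetric group on `{0, …, n-1}`. -/
def simple {n : ℕ} (i : Fin (n - 1)) : Equiv.Perm (Fin n) :=
  Equiv.swap ⟨i, by omega⟩ ⟨i + 1, by omega⟩

/-- The product `s_{i_1} ⋯ s_{i_m}` of a word in the simple transpositions. -/
def wordProd {n : ℕ} (ω : List (Fin (n - 1))) : Equiv.Perm (Fin n) :=
  (ω.map simple).prod

/-- The Coxeter length: the least length of a word in the simple transpositions with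
product `w`. -/
def length {n : ℕ} (w : Equiv.Perm (Fin n)) : ℕ :=
  sInf {m : ℕ | ∃ ω : List (Fin (n - 1)), ω.length = m ∧ wordProd ω = w}

theorem exists_word {n : ℕ} (w : Equiv.Perm (Fin n)) :
    ∃ ω : List (Fin (n - 1)), wordProd ω = w := by
  cases n with
  | zero => exact ⟨[], Subsingleton.elim _ _⟩
  | succ n =>
    have hw : w ∈ Submonoid.closure
        (Set.range fun i : Fin n => Equiv.swap i.castSucc i.succ) := by
      rw [Equiv.Perm.mclosure_swap_castSucc_succ]
      trivial
    induction hw using Submonoid.closure_induction with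
    | mem x hx =>
      obtain ⟨i, rfl⟩ := hx
      exact ⟨[i], by simp only [wordProd, List.map_cons, List.map_nil, List.prod_singleton]; rfl⟩
    | one => exact ⟨[], rfl⟩
    | mul x y _ _ hx hy =>
      obtain ⟨a, rfl⟩ := hx
      obtain ⟨b, rfl⟩ := hy
      exact ⟨a ++ b, by simp [wordProd]⟩

theorem exists_reducedWord {n : ℕ} (w : Equiv.Perm (Fin n)) :
    ∃ ω : List (Fin (n - 1)), ω.length = length w ∧ wordProd ω = w := by
  obtain ⟨ω, hω⟩ := exists_word w
  exact Nat.sInf_mem (s := {m : ℕ | ∃ ω : List (Fin (n - 1)), ω.length = m ∧ wordProd ω = w})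
    ⟨ω.length, ω, rfl, hω⟩

/-- A reduced word of `w`. -/
def reducedWord {n : ℕ} (w : Equiv.Perm (Fin n)) : List (Fin (n - 1)) :=
  (exists_reducedWord w).choose

/-! ### The Hecke algebra in its standard basis -/

/-- The (underlying module of the) Hecke algebra of the symmetric group over `ℤ[q, q⁻¹]`,
free on the standard basis `T_w`. The variable `q` is `LaurentPolynomial.T 1`. -/
abbrev Hecke (n : ℕ) : Type := Equiv.Perm (Fin n) →₀ ℤ[T;T⁻¹]

/-- The standard basis element `T_w`. -/
def stdBasis {n : ℕ} (w : Equiv.Perm (Fin n)) : Hecke n := Finsupp.single w 1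

/-- The variable `q`. -/
def q : ℤ[T;T⁻¹] := LaurentPolynomial.T 1

/-- The inverse `q⁻¹` of the variable. -/
def qInv : ℤ[T;T⁻¹] := LaurentPolynomial.T (-1)

/-- Left multiplication by the generator `T_s`, `s = s_i`, in the Hecke algebra:
`T_s T_w = T_{sw}` if `ℓ(sw) > ℓ(w)`, and `T_s T_w = (q - 1) T_w + q T_{sw}` otherwise. -/
def genMul {n : ℕ} (i : Fin (n - 1)) : Hecke n →ₗ[ℤ[T;T⁻¹]] Hecke n :=
  Finsupp.linearCombination ℤ[T;T⁻¹] fun w : Equiv.Perm (Fin n) =>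
    if length w < length (simple i * w) then stdBasis (simple i * w)
    else (q - 1) • stdBasis w + q • stdBasis (simple i * w)

/-- Left multiplication by the inverse of a generator,
`T_s⁻¹ = q⁻¹ T_s + (q⁻¹ - 1)`, as follows from `T_s² = (q - 1) T_s + q`. -/
def genInvMul {n : ℕ} (i : Fin (n - 1)) : Hecke n →ₗ[ℤ[T;T⁻¹]] Hecke n :=
  qInv • genMul i + (qInv - 1) • LinearMap.id

/-- The value of the bar involution on a standard basis element:
if `w = s_{i_1} ⋯ s_{i_m}` is reduced, then
`(T_{w⁻¹})⁻¹ = T_{s_{i_1}}⁻¹ ⋯ T_{s_{i_m}}⁻¹`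
(this does not depend on the reduced word). -/
def barBasis {n : ℕ} (w : Equiv.Perm (Fin n)) : Hecke n :=
  ((reducedWord w).map genInvMul).foldr (fun f h => f h) (stdBasis 1)

/-- The bar involution: `q ↦ q⁻¹` and `T_w ↦ (T_{w⁻¹})⁻¹`. -/
def bar {n : ℕ} (h : Hecke n) : Hecke n :=
  h.sum fun w a => LaurentPolynomial.invert a • barBasis w

/-! ### Kazhdan--Lusztig polynomials -/

/-- `P` is the family `y ↦ P_{y,w}` of Kazhdan--Lusztig polynomials for `w`: one has
`P_{w,w} = 1`, `deg P_{y,w} ≤ (ℓ(w) - ℓ(y) - 1) / 2` for `y ≠ w` with `P_{y,w} ≠ 0`, and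
`q^{-ℓ(w)/2} ∑_y P_{y,w}(q) T_y` is fixed by the bar involution, which is written here without
square roots as `bar (∑_y P_{y,w} T_y) = q^{-ℓ(w)} ∑_y P_{y,w} T_y`.
(There is exactly one such family, and its support is the Bruhat interval below `w`.) -/
def IsKLFamily {n : ℕ} (w : Equiv.Perm (Fin n)) (P : Equiv.Perm (Fin n) → Polynomial ℤ) : Prop :=
  P w = 1 ∧
  (∀ y, y ≠ w → P y ≠ 0 → 2 * (P y).natDegree + length y + 1 ≤ length w) ∧
  bar (∑ y, (P y).toLaurent • stdBasis y) =
    (LaurentPolynomial.T (-(length w : ℤ)) : ℤ[T;T⁻¹]) • ∑ y, (P y).toLaurent • stdBasis y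

open Classical in
/-- The Kazhdan--Lusztig polynomial `P_{y,w}`. -/
def klPoly {n : ℕ} (y w : Equiv.Perm (Fin n)) : Polynomial ℤ :=
  if h : ∃ P, IsKLFamily w P then h.choose y else 0

/-! ### The growth sequences -/

/-- The largest among the coefficients of `p` in degrees `0, …, deg p`. -/
def maxCoeff (p : Polynomial ℤ) : ℤ :=
  (Finset.range (p.natDegree + 1)).sup' (by simp) p.coeff

/-- `coeff_n`: the maximal coefficient of the polynomials `P_{1,w}`, `w` in the symmetric group
on `n` letters. -/
def coeffMax (n : ℕ) : ℤ :=
  (Finset.univ : Finset (Equiv.Perm (Fin n))).sup' Finset.univ_nonempty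
    fun w => maxCoeff (klPoly 1 w)

/-- `ev_n`: the maximal value `P_{1,w}(1)`, `w` in the symmetric group on `n` letters. -/
def evMax (n : ℕ) : ℤ :=
  (Finset.univ : Finset (Equiv.Perm (Fin n))).sup' Finset.univ_nonempty
    fun w => (klPoly 1 w).eval 1

/-- `f ∈ Ω(g)`. -/
def IsOmega (f g : ℕ → ℝ) : Prop :=
  ∃ C : ℝ, 0 < C ∧ ∃ n₀ : ℕ, ∀ n : ℕ, n₀ < n → C * g n ≤ |f n|

/-! ### The permutations `w_l^k` and the conjectures -/

/-- The permutation `u_l^k` of `n = k + 2l` letters, in one-line notation (with letters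
`1, …, n`) `(n-l+1, …, n, l+1, …, n-l, 1, …, l)`. -/
def uPerm (k l : ℕ) : Equiv.Perm (Fin (k + 2 * l)) :=
  Function.Involutive.toPerm
    (fun i : Fin (k + 2 * l) =>
      ⟨if (i : ℕ) < l then i + (k + l) else if (i : ℕ) < l + k then i else i - (k + l),
        by split_ifs <;> omega⟩)
    (by
      intro i
      apply Fin.ext
      dsimp only
      split_ifs <;> omega)

/-- The permutation `w_0^l ⊗ id_k ⊗ w_0^l` of `k + 2l` letters: it reverses the first `l` letters
and the last `l` letters, and fixes the `k` letters in the middle. -/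
def flankPerm (k l : ℕ) : Equiv.Perm (Fin (k + 2 * l)) :=
  Function.Involutive.toPerm
    (fun i : Fin (k + 2 * l) =>
      ⟨if (i : ℕ) < l then l - 1 - i
        else if (i : ℕ) < l + k then i else (l + k) + (k + 2 * l - 1 - i),
        by split_ifs <;> omega⟩)
    (by
      intro i
      apply Fin.ext
      dsimp only
      split_ifs <;> omega)

/-- `w_l^k = (w_0^l ⊗ id_k ⊗ w_0^l) ∘ u_l^k`. -/
def wPerm (k l : ℕ) : Equiv.Perm (Fin (k + 2 * l)) := flankPerm k l * uPerm k l

/-- The product formula `P_{1,w_l^k} = (1 + v + ⋯ + v^l)^{k-1}` for a given `l` and all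
`k ≥ 1`. -/
def ProductFormula (l : ℕ) : Prop :=
  ∀ k : ℕ, 1 ≤ k →
    klPoly 1 (wPerm k l) =
      (∑ i ∈ Finset.range (l + 1), (Polynomial.X : Polynomial ℤ) ^ i) ^ (k - 1)

/-- The product formula conjecture: the formula holds for every `l`. -/
def ProductConjecture : Prop := ∀ l : ℕ, ProductFormula l

/-- A sequence of integers grows superexponentially: it is in `Ω(γ^n)` for all real `γ > 1`. -/
def SuperexponentialGrowth (f : ℕ → ℤ) : Prop :=
  ∀ γ : ℝ, 1 < γ → IsOmega (fun n => (f n : ℝ)) (fun n => γ ^ n)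

end

end KLGrowth

/-! For `l = 1` the permutation `w_1^k` is the transposition of the first and last of `n = k + 2`
letters, and its Kazhdan--Lusztig element can be built explicitly. If `s` exchanges `a` and `a + 1`,
then `s (a+1, e) s = (a, e)`, so the candidate is `(1 + T_s) C (1 + T_s)`, where `C` belongs to
`(a+1, e)`. Bar invariance up to the right power of `q` is inherited, because `1 + T_s` is a bar
eigenvector for `q⁻¹` and bar is compatible with left and right multiplication.

The degree bounds need a stronger induction hypothesis. A term `q^d T_y` of `C` with `y` fixing `a +
1` commutes with `s` and produces `q^(d+1) T_{sy}`, which costs one more unit of slack than the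
other terms do; `TermBound` provides that unit. With it no lower Kazhdan--Lusztig element has to be
subtracted (`klMul_klMulRight_mem`). Only the start, on three consecutive letters, needs the
correction `(1 + T_s)(1 + T_t)(1 + T_s) - q (1 + T_s)`. Since `y` never involves `s`, only `T_1`
feeds the coefficient of `T_1`, which is therefore multiplied by `1 + q` at each step. This gives `P
= (1 + v)^(k-1)`.

To identify these elements with `klPoly`, bar must be well defined and the family unique. Both rest
on commuting left and right multiplication (`genMul_comp_genMulRight`), which replaces the braid
relations, and on unitriangularity of bar up to powers of `q` (`barBasis_sub_mem_lowerSpan`).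

The growth statements follow from `P(1) = (l + 1)^(k-1)` with `l` fixed and `n = k + 2l`. The
largest coefficient is at least `P(1)` divided by the number of coefficients; for `l = 1` it is
bounded below by a middle binomial coefficient, of order `2^n / √n`. -/

open scoped LaurentPolynomial

namespace KLGrowth

noncomputable section

/-! ### Length and inversions -/

variable {n : ℕ}

/-- The smaller of the two letters exchanged by `s_i`. -/
def lo (i : Fin (n - 1)) : Fin n := ⟨i, by omega⟩

/-- The larger of the two letters exchanged by `s_i`. -/
def hi (i : Fin (n - 1)) : Fin n := ⟨i + 1, by omega⟩

theorem simple_eq_swap (i : Fin (n - 1)) : simple i = Equiv.swap (lo i) (hi i) := rfl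

theorem lo_lt_hi (i : Fin (n - 1)) : lo i < hi i := by
  simp [lo, hi, Fin.lt_def]

@[simp] theorem simple_mul_self (i : Fin (n - 1)) : simple i * simple i = 1 :=
  Equiv.swap_mul_self _ _

@[simp] theorem simple_inv (i : Fin (n - 1)) : (simple i)⁻¹ = simple i :=
  Equiv.swap_inv _ _

@[simp] theorem simple_mul_cancel (i : Fin (n - 1)) (w : Equiv.Perm (Fin n)) :
    simple i * (simple i * w) = w := by
  rw [← mul_assoc, simple_mul_self, one_mul]

@[simp] theorem mul_simple_cancel (i : Fin (n - 1)) (w : Equiv.Perm (Fin n)) :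
    w * simple i * simple i = w := by
  rw [mul_assoc, simple_mul_self, mul_one]

@[simp] theorem simple_lo (i : Fin (n - 1)) : simple i (lo i) = hi i :=
  Equiv.swap_apply_left _ _

@[simp] theorem simple_hi (i : Fin (n - 1)) : simple i (hi i) = lo i :=
  Equiv.swap_apply_right _ _

@[simp] theorem simple_simple (i : Fin (n - 1)) (a : Fin n) : simple i (simple i a) = a :=
  Equiv.swap_apply_self _ _ _

theorem simple_apply_val (i : Fin (n - 1)) (a : Fin n) :
    (simple i a : ℕ) = if (a : ℕ) = i then (i : ℕ) + 1 else if (a : ℕ) = i + 1 then (i : ℕ)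
      else a := by
  unfold simple
  rw [Equiv.swap_apply_def]
  simp only [Fin.ext_iff]
  split_ifs <;> rfl

theorem simple_lt_simple {i : Fin (n - 1)} {a b : Fin n} (h : a < b)
    (hne : ¬(a = lo i ∧ b = hi i)) : simple i a < simple i b := by
  simp only [lo, hi, Fin.ext_iff, Fin.lt_def] at *
  rw [simple_apply_val, simple_apply_val]
  split_ifs <;> omega

/-- The set of inversions of a permutation. -/
def invSet (w : Equiv.Perm (Fin n)) : Finset (Fin n × Fin n) :=
  {p | p.1 < p.2 ∧ w p.2 < w p.1}

theorem mem_invSet {w : Equiv.Perm (Fin n)} {p : Fin n × Fin n} :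
    p ∈ invSet w ↔ p.1 < p.2 ∧ w p.2 < w p.1 := by
  simp [invSet]

/-- `s_i` preserves the order of every pair of letters except the adjacent pair it exchanges. It
thus carries the inversions of `w` to those of `w s_i` apart from that one pair. -/
theorem card_invSet_mul_simple {w : Equiv.Perm (Fin n)} {i : Fin (n - 1)}
    (h : w (lo i) < w (hi i)) : (invSet (w * simple i)).card = (invSet w).card + 1 := by
  have key : invSet (w * simple i) =
      insert (lo i, hi i) ((invSet w).map (Equiv.prodCongr (simple i) (simple i)).toEmbedding) := by
    ext ⟨a, b⟩
    simp only [mem_invSet, Finset.mem_insert, Finset.mem_map, Prod.mk.injEq,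
      Equiv.Perm.mul_apply, Equiv.coe_toEmbedding, Prod.exists, Equiv.prodCongr_apply, Prod.map]
    constructor
    · rintro ⟨hab, hw⟩
      by_cases hne : a = lo i ∧ b = hi i
      · exact Or.inl hne
      · exact Or.inr ⟨simple i a, simple i b, ⟨simple_lt_simple hab hne, hw⟩, by simp⟩
    · rintro (⟨rfl, rfl⟩ | ⟨c, d, ⟨hcd, hw⟩, rfl, rfl⟩)
      · exact ⟨lo_lt_hi i, by simpa using h⟩
      · refine ⟨simple_lt_simple hcd ?_, by simpa using hw⟩
        rintro ⟨rfl, rfl⟩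
        exact lt_asymm h hw
  rw [key, Finset.card_insert_of_notMem, Finset.card_map]
  simp only [Finset.mem_map, mem_invSet, Prod.exists, Equiv.coe_toEmbedding,
    Equiv.prodCongr_apply, Prod.map, Prod.mk.injEq, not_exists]
  rintro a b ⟨⟨hab, -⟩, ha, hb⟩
  rw [← simple_hi, EmbeddingLike.apply_eq_iff_eq] at ha
  rw [← simple_lo, EmbeddingLike.apply_eq_iff_eq] at hb
  rw [ha, hb] at hab
  exact lt_asymm hab (lo_lt_hi i)

theorem apply_lo_ne_hi (w : Equiv.Perm (Fin n)) (i : Fin (n - 1)) : w (lo i) ≠ w (hi i) :=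
  w.injective.ne (lo_lt_hi i).ne

theorem card_invSet_mul_simple_of_gt {w : Equiv.Perm (Fin n)} {i : Fin (n - 1)}
    (h : w (hi i) < w (lo i)) : (invSet w).card = (invSet (w * simple i)).card + 1 := by
  have := card_invSet_mul_simple (w := w * simple i) (i := i) (by simpa using h)
  rwa [mul_simple_cancel] at this

/-- A strictly increasing self-bijection of a finite chain is the identity. -/
theorem eq_one_of_no_descent {w : Equiv.Perm (Fin n)}
    (h : ∀ i : Fin (n - 1), w (lo i) < w (hi i)) : w = 1 := by
  cases n with
  | zero => exact Subsingleton.elim _ _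
  | succ n =>
    have hmono : StrictMono w := Fin.strictMono_iff_lt_succ.2 fun i => h i
    have := Subsingleton.elim (hmono.orderIsoOfSurjective _ w.surjective) (OrderIso.refl _)
    ext x
    exact congrArg Fin.val (DFunLike.congr_fun this x)

/-! ### Words, and length as the number of inversions -/

theorem wordProd_nil : wordProd ([] : List (Fin (n - 1))) = 1 := rfl

theorem wordProd_cons (i : Fin (n - 1)) (ω : List (Fin (n - 1))) :
    wordProd (i :: ω) = simple i * wordProd ω := by
  simp [wordProd]

theorem wordProd_append (ω ω' : List (Fin (n - 1))) :
    wordProd (ω ++ ω') = wordProd ω * wordProd ω' := by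
  simp [wordProd]

theorem wordProd_reverse (ω : List (Fin (n - 1))) :
    wordProd ω.reverse = (wordProd ω)⁻¹ := by
  induction ω with
  | nil => simp [wordProd]
  | cons i ω ih =>
    rw [List.reverse_cons, wordProd_append, ih, wordProd_cons, wordProd_cons, wordProd_nil]
    simp

theorem length_le_of_wordProd {w : Equiv.Perm (Fin n)} {ω : List (Fin (n - 1))}
    (h : wordProd ω = w) : length w ≤ ω.length :=
  Nat.sInf_le ⟨ω, rfl, h⟩

theorem card_invSet_wordProd_le (ω : List (Fin (n - 1))) :
    (invSet (wordProd ω)).card ≤ ω.length := by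
  induction ω using List.reverseRecOn with
  | nil =>
    rw [wordProd_nil, List.length_nil, Nat.le_zero, Finset.card_eq_zero]
    ext p
    simp only [mem_invSet, Equiv.Perm.one_apply, Finset.notMem_empty, iff_false, not_and]
    exact lt_asymm
  | append_singleton ω i ih =>
    rw [wordProd_append, List.length_append, wordProd_cons, wordProd_nil, mul_one]
    rcases (apply_lo_ne_hi (wordProd ω) i).lt_or_gt with h | h
    · rw [card_invSet_mul_simple h]
      exact Nat.add_le_add_right ih _
    · have := card_invSet_mul_simple_of_gt h
      simp only [List.length_singleton]
      omega

/-- Bubble sort: a nontrivial permutation has a descent, and removing it lowers the number of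
inversions by exactly one. -/
theorem exists_word_length_eq_card_invSet (w : Equiv.Perm (Fin n)) :
    ∃ ω : List (Fin (n - 1)), ω.length = (invSet w).card ∧ wordProd ω = w := by
  induction hm : (invSet w).card generalizing w with
  | zero =>
    refine ⟨[], rfl, ?_⟩
    rw [wordProd_nil, eq_comm]
    refine eq_one_of_no_descent fun i => ?_
    rcases (apply_lo_ne_hi w i).lt_or_gt with h | h
    · exact h
    · have := card_invSet_mul_simple_of_gt h
      omega
  | succ m ih =>
    obtain ⟨i, hi'⟩ : ∃ i : Fin (n - 1), w (hi i) < w (lo i) := by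
      by_contra! hcon
      have hw := eq_one_of_no_descent
        fun i => lt_of_le_of_ne (hcon i) (apply_lo_ne_hi w i)
      have := card_invSet_wordProd_le ([] : List (Fin (n - 1)))
      rw [wordProd_nil, ← hw, hm] at this
      simp at this
    have hc := card_invSet_mul_simple_of_gt hi'
    obtain ⟨ω, hω, hωw⟩ := ih (w * simple i) (by omega)
    refine ⟨ω ++ [i], by simp [hω], ?_⟩
    rw [wordProd_append, hωw, wordProd_cons, wordProd_nil, mul_one, mul_simple_cancel]

theorem length_eq_card_invSet (w : Equiv.Perm (Fin n)) : length w = (invSet w).card := by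
  obtain ⟨ω, hω, hωw⟩ := exists_word_length_eq_card_invSet w
  obtain ⟨ω', hω', hωw'⟩ := exists_reducedWord w
  refine le_antisymm (hω ▸ length_le_of_wordProd hωw) ?_
  rw [← hω', ← hωw']
  exact card_invSet_wordProd_le ω'

@[simp] theorem length_one : length (1 : Equiv.Perm (Fin n)) = 0 :=
  Nat.le_zero.1 (length_le_of_wordProd (ω := []) wordProd_nil)

theorem length_inv_le (w : Equiv.Perm (Fin n)) : length w⁻¹ ≤ length w := by
  obtain ⟨ω, hω, rfl⟩ := exists_reducedWord w
  rw [← hω, ← List.length_reverse]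
  exact length_le_of_wordProd (wordProd_reverse ω)

@[simp] theorem length_inv (w : Equiv.Perm (Fin n)) : length w⁻¹ = length w :=
  le_antisymm (length_inv_le w) (by simpa using length_inv_le w⁻¹)

theorem length_mul_simple {w : Equiv.Perm (Fin n)} {i : Fin (n - 1)}
    (h : w (lo i) < w (hi i)) : length (w * simple i) = length w + 1 := by
  rw [length_eq_card_invSet, length_eq_card_invSet, card_invSet_mul_simple h]

theorem length_mul_simple_of_gt {w : Equiv.Perm (Fin n)} {i : Fin (n - 1)}
    (h : w (hi i) < w (lo i)) : length w = length (w * simple i) + 1 := by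
  rw [length_eq_card_invSet, length_eq_card_invSet, card_invSet_mul_simple_of_gt h]

theorem length_simple_mul_eq (w : Equiv.Perm (Fin n)) (i : Fin (n - 1)) :
    length (simple i * w) = length (w⁻¹ * simple i) := by
  rw [← length_inv, mul_inv_rev, simple_inv]

theorem length_simple_mul {w : Equiv.Perm (Fin n)} {i : Fin (n - 1)}
    (h : w⁻¹ (lo i) < w⁻¹ (hi i)) : length (simple i * w) = length w + 1 := by
  rw [length_simple_mul_eq, length_mul_simple h, length_inv]

theorem length_simple_mul_of_gt {w : Equiv.Perm (Fin n)} {i : Fin (n - 1)}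
    (h : w⁻¹ (hi i) < w⁻¹ (lo i)) : length w = length (simple i * w) + 1 := by
  rw [length_simple_mul_eq, ← length_mul_simple_of_gt h, length_inv]

theorem length_lt_mul_simple_iff {w : Equiv.Perm (Fin n)} {i : Fin (n - 1)} :
    length w < length (w * simple i) ↔ w (lo i) < w (hi i) := by
  constructor
  · intro h
    refine (apply_lo_ne_hi w i).lt_or_gt.resolve_right fun hlt => ?_
    have := length_mul_simple_of_gt hlt
    omega
  · intro h
    rw [length_mul_simple h]
    omega

theorem length_lt_simple_mul_iff {w : Equiv.Perm (Fin n)} {i : Fin (n - 1)} :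
    length w < length (simple i * w) ↔ w⁻¹ (lo i) < w⁻¹ (hi i) := by
  rw [length_simple_mul_eq, ← length_inv w, length_lt_mul_simple_iff]

theorem length_simple_mul_of_not_lt {w : Equiv.Perm (Fin n)} {i : Fin (n - 1)}
    (h : ¬length w < length (simple i * w)) : length w = length (simple i * w) + 1 := by
  rw [length_lt_simple_mul_iff] at h
  exact length_simple_mul_of_gt ((apply_lo_ne_hi w⁻¹ i).lt_or_gt.resolve_left h)

theorem length_simple_mul_of_lt {w : Equiv.Perm (Fin n)} {i : Fin (n - 1)}
    (h : length w < length (simple i * w)) : length (simple i * w) = length w + 1 :=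
  length_simple_mul (length_lt_simple_mul_iff.1 h)

/-- Left multiplication by `s` changes the right descents of `w` at `t` only if `sw = wt`. -/
theorem lt_simple_mul_mul_simple_iff {w : Equiv.Perm (Fin n)} {i j : Fin (n - 1)}
    (hne : simple i * w ≠ w * simple j) :
    length (simple i * w) < length (simple i * w * simple j) ↔
      length w < length (w * simple j) := by
  rw [length_lt_mul_simple_iff, length_lt_mul_simple_iff, Equiv.Perm.mul_apply,
    Equiv.Perm.mul_apply]
  -- `s_i` can reverse the comparison of `w (lo j)` and `w (hi j)` only if these are the two letters
  -- it exchanges; then `w s_j w⁻¹ = s_i`, which is excluded.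
  have hswap : ∀ a b : Fin n, a = lo i → b = hi i → a = w (lo j) ∧ b = w (hi j) ∨
      b = w (lo j) ∧ a = w (hi j) → False := by
    rintro a b rfl rfl h
    apply hne
    rw [simple_eq_swap j, Equiv.mul_swap_eq_swap_mul, simple_eq_swap i]
    rcases h with ⟨h₁, h₂⟩ | ⟨h₁, h₂⟩
    · rw [← h₁, ← h₂]
    · rw [← h₁, ← h₂, Equiv.swap_comm]
  constructor
  · intro h
    have := simple_lt_simple (i := i) h ?_
    · simpa using this
    · rintro ⟨h₁, h₂⟩
      refine hswap _ _ rfl rfl (Or.inr ⟨?_, ?_⟩)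
      · rw [← simple_lo, ← h₁, simple_simple]
      · rw [← simple_hi, ← h₂, simple_simple]
  · intro h
    exact simple_lt_simple h fun hh => hswap _ _ rfl rfl (Or.inl ⟨hh.1.symm, hh.2.symm⟩)

/-! ### Left and right multiplication in the Hecke algebra -/

/-- Right multiplication by the generator `T_s`. -/
def genMulRight (i : Fin (n - 1)) : Hecke n →ₗ[ℤ[T;T⁻¹]] Hecke n :=
  Finsupp.linearCombination ℤ[T;T⁻¹] fun w : Equiv.Perm (Fin n) =>
    if length w < length (w * simple i) then stdBasis (w * simple i)
    else (q - 1) • stdBasis w + q • stdBasis (w * simple i)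

/-- Right multiplication by the inverse of a generator. -/
def genInvMulRight (i : Fin (n - 1)) : Hecke n →ₗ[ℤ[T;T⁻¹]] Hecke n :=
  qInv • genMulRight i + (qInv - 1) • LinearMap.id

theorem q_mul_qInv : q * qInv = 1 := by
  rw [q, qInv, ← LaurentPolynomial.T_add]
  exact LaurentPolynomial.T_zero

theorem qInv_mul_q : qInv * q = 1 := by
  rw [mul_comm, q_mul_qInv]

@[simp] theorem invert_q : LaurentPolynomial.invert q = qInv := by
  simp [q, qInv]

theorem linearMap_ext_stdBasis {M : Type*} [AddCommMonoid M] [Module ℤ[T;T⁻¹] M]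
    {f g : Hecke n →ₗ[ℤ[T;T⁻¹]] M} (h : ∀ w, f (stdBasis w) = g (stdBasis w)) : f = g :=
  Finsupp.lhom_ext' fun w => LinearMap.ext_ring (h w)

theorem genMul_stdBasis (i : Fin (n - 1)) (w : Equiv.Perm (Fin n)) :
    genMul i (stdBasis w) = if length w < length (simple i * w) then stdBasis (simple i * w)
      else (q - 1) • stdBasis w + q • stdBasis (simple i * w) := by
  simp [genMul, stdBasis]

theorem genMul_stdBasis_of_lt {i : Fin (n - 1)} {w : Equiv.Perm (Fin n)}
    (h : length w < length (simple i * w)) :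
    genMul i (stdBasis w) = stdBasis (simple i * w) := by
  rw [genMul_stdBasis, if_pos h]

theorem genMul_stdBasis_of_not_lt {i : Fin (n - 1)} {w : Equiv.Perm (Fin n)}
    (h : ¬length w < length (simple i * w)) :
    genMul i (stdBasis w) = (q - 1) • stdBasis w + q • stdBasis (simple i * w) := by
  rw [genMul_stdBasis, if_neg h]

theorem genMulRight_stdBasis (i : Fin (n - 1)) (w : Equiv.Perm (Fin n)) :
    genMulRight i (stdBasis w) =
      if length w < length (w * simple i) then stdBasis (w * simple i)
      else (q - 1) • stdBasis w + q • stdBasis (w * simple i) := by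
  simp [genMulRight, stdBasis]

theorem genMulRight_stdBasis_of_lt {i : Fin (n - 1)} {w : Equiv.Perm (Fin n)}
    (h : length w < length (w * simple i)) :
    genMulRight i (stdBasis w) = stdBasis (w * simple i) := by
  rw [genMulRight_stdBasis, if_pos h]

theorem genMulRight_stdBasis_of_not_lt {i : Fin (n - 1)} {w : Equiv.Perm (Fin n)}
    (h : ¬length w < length (w * simple i)) :
    genMulRight i (stdBasis w) = (q - 1) • stdBasis w + q • stdBasis (w * simple i) := by
  rw [genMulRight_stdBasis, if_neg h]

theorem genMul_comp_genMul (i : Fin (n - 1)) :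
    genMul i ∘ₗ genMul i = (q - 1) • genMul i + q • LinearMap.id := by
  refine linearMap_ext_stdBasis fun w => ?_
  by_cases h : length w < length (simple i * w)
  · have h' : ¬length (simple i * w) < length (simple i * (simple i * w)) := by
      rw [simple_mul_cancel]
      exact h.not_gt
    simp [genMul_stdBasis_of_lt h, genMul_stdBasis_of_not_lt h']
  · have h' : length (simple i * w) < length (simple i * (simple i * w)) := by
      rw [simple_mul_cancel, length_simple_mul_of_not_lt h]
      exact Nat.lt_succ_self _
    simp [genMul_stdBasis_of_not_lt h, genMul_stdBasis_of_lt h']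

theorem genMul_genMul (i : Fin (n - 1)) (h : Hecke n) :
    genMul i (genMul i h) = (q - 1) • genMul i h + q • h :=
  LinearMap.congr_fun (genMul_comp_genMul i) h

theorem genInvMul_apply (i : Fin (n - 1)) (h : Hecke n) :
    genInvMul i h = qInv • genMul i h + (qInv - 1) • h := rfl

theorem genInvMulRight_apply (i : Fin (n - 1)) (h : Hecke n) :
    genInvMulRight i h = qInv • genMulRight i h + (qInv - 1) • h := rfl

theorem genInvMul_genMul (i : Fin (n - 1)) (h : Hecke n) : genInvMul i (genMul i h) = h := by
  rw [genInvMul_apply, genMul_genMul]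
  linear_combination (norm := module) qInv_mul_q • h + qInv_mul_q • genMul i h

theorem genMul_genInvMul (i : Fin (n - 1)) (h : Hecke n) : genMul i (genInvMul i h) = h := by
  rw [genInvMul_apply, map_add, map_smul, map_smul, genMul_genMul]
  linear_combination (norm := module) qInv_mul_q • h + qInv_mul_q • genMul i h

/-- This is the associativity `T_s (T_w T_t) = (T_s T_w) T_t`. If `sw = wt`, the left and right
descents at `w` agree and both sides are computed directly. Otherwise multiplying on one side does
not affect descents on the other, and the two operations act independently. -/
theorem genMul_comp_genMulRight (i j : Fin (n - 1)) :
    genMul i ∘ₗ genMulRight j = genMulRight j ∘ₗ genMul i := by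
  refine linearMap_ext_stdBasis fun w => ?_
  simp only [LinearMap.comp_apply]
  by_cases he : simple i * w = w * simple j
  · have he' : simple i * w * simple j = w := by rw [he, mul_simple_cancel]
    have he'' : simple i * (w * simple j) = w := by rw [← mul_assoc, he']
    by_cases h : length w < length (simple i * w)
    · have h' : ¬length (simple i * w) < length (simple i * w * simple j) := by
        rw [he']
        exact h.not_gt
      have h'' : ¬length (w * simple j) < length (simple i * (w * simple j)) := by
        rw [he'', ← he]
        exact h.not_gt
      rw [genMul_stdBasis_of_lt h, genMulRight_stdBasis_of_lt (he ▸ h),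
        genMulRight_stdBasis_of_not_lt h', genMul_stdBasis_of_not_lt h'', he', he'', he]
    · have hr := length_simple_mul_of_not_lt h
      have h' : length (simple i * w) < length (simple i * w * simple j) := by
        rw [he']
        omega
      have h'' : length (w * simple j) < length (simple i * (w * simple j)) := by
        rw [he'', ← he]
        omega
      rw [genMul_stdBasis_of_not_lt h, genMulRight_stdBasis_of_not_lt (he ▸ h)]
      simp only [map_add, map_smul]
      rw [genMul_stdBasis_of_not_lt h, genMulRight_stdBasis_of_not_lt (he ▸ h),
        genMulRight_stdBasis_of_lt h', genMul_stdBasis_of_lt h'', he', he'', he]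
  · have hR := lt_simple_mul_mul_simple_iff he
    have hL : length (w * simple j) < length (simple i * (w * simple j)) ↔
        length w < length (simple i * w) := by
      have := lt_simple_mul_mul_simple_iff (w := w⁻¹) (i := j) (j := i) fun hc => he (by
        simpa using congrArg (·⁻¹) hc.symm)
      rw [← length_inv, ← length_inv (simple j * w⁻¹ * simple i), length_inv w,
        ← length_inv (w⁻¹ * simple i)] at this
      simpa using this
    rw [mul_assoc] at hR
    by_cases h₁ : length w < length (simple i * w) <;>
      by_cases h₂ : length w < length (w * simple j) <;>
      simp only [genMul_stdBasis, genMulRight_stdBasis, h₁, h₂, if_true, if_false, map_add,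
        map_smul, hR, hL, mul_assoc]
    module

theorem genMul_genMulRight (i j : Fin (n - 1)) (h : Hecke n) :
    genMul i (genMulRight j h) = genMulRight j (genMul i h) :=
  LinearMap.congr_fun (genMul_comp_genMulRight i j) h

theorem genInvMul_genInvMulRight (i j : Fin (n - 1)) (h : Hecke n) :
    genInvMul i (genInvMulRight j h) = genInvMulRight j (genInvMul i h) := by
  simp only [genInvMul_apply, genInvMulRight_apply, map_add, map_smul, genMul_genMulRight]
  module

/-! ### Products of generators along words -/

/-- Left multiplication by `T_{s_{i_1}} ⋯ T_{s_{i_m}}`. -/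
def wordMul (ω : List (Fin (n - 1))) : Module.End ℤ[T;T⁻¹] (Hecke n) := (ω.map genMul).prod

/-- Left multiplication by `T_{s_{i_1}}⁻¹ ⋯ T_{s_{i_m}}⁻¹`. -/
def wordInvMul (ω : List (Fin (n - 1))) : Module.End ℤ[T;T⁻¹] (Hecke n) :=
  (ω.map genInvMul).prod

theorem wordMul_cons (i : Fin (n - 1)) (ω : List (Fin (n - 1))) (h : Hecke n) :
    wordMul (i :: ω) h = genMul i (wordMul ω h) := by
  simp [wordMul]

theorem wordInvMul_cons (i : Fin (n - 1)) (ω : List (Fin (n - 1))) (h : Hecke n) :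
    wordInvMul (i :: ω) h = genInvMul i (wordInvMul ω h) := by
  simp [wordInvMul]

theorem wordMul_reverse_cons (i : Fin (n - 1)) (ω : List (Fin (n - 1))) (h : Hecke n) :
    wordMul (i :: ω).reverse h = wordMul ω.reverse (genMul i h) := by
  simp [wordMul]

theorem wordMul_genMulRight (ω : List (Fin (n - 1))) (j : Fin (n - 1)) (h : Hecke n) :
    wordMul ω (genMulRight j h) = genMulRight j (wordMul ω h) := by
  induction ω with
  | nil => rfl
  | cons i ω ih => rw [wordMul_cons, wordMul_cons, ih, genMul_genMulRight]

theorem wordInvMul_wordMul_reverse (ω : List (Fin (n - 1))) (h : Hecke n) :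
    wordInvMul ω (wordMul ω.reverse h) = h := by
  induction ω generalizing h with
  | nil => rfl
  | cons i ω ih => rw [wordInvMul_cons, wordMul_reverse_cons, ih, genInvMul_genMul]

theorem wordMul_reverse_wordInvMul (ω : List (Fin (n - 1))) (h : Hecke n) :
    wordMul ω.reverse (wordInvMul ω h) = h := by
  induction ω generalizing h with
  | nil => rfl
  | cons i ω ih => rw [wordInvMul_cons, wordMul_reverse_cons, genMul_genInvMul, ih]

/-- A word is reduced if it has the length of its product. -/
def IsReduced (ω : List (Fin (n - 1))) : Prop := ω.length = length (wordProd ω)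

theorem length_simple_mul_le (i : Fin (n - 1)) (w : Equiv.Perm (Fin n)) :
    length (simple i * w) ≤ length w + 1 := by
  by_cases h : length w < length (simple i * w)
  · exact (length_simple_mul_of_lt h).le
  · omega

theorem IsReduced.tail {i : Fin (n - 1)} {ω : List (Fin (n - 1))} (h : IsReduced (i :: ω)) :
    IsReduced ω := by
  rw [IsReduced, wordProd_cons, List.length_cons] at h
  have h₁ := length_simple_mul_le i (wordProd ω)
  exact le_antisymm (by omega) (length_le_of_wordProd rfl)

theorem IsReduced.lt {i : Fin (n - 1)} {ω : List (Fin (n - 1))} (h : IsReduced (i :: ω)) :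
    length (wordProd ω) < length (simple i * wordProd ω) := by
  have h₁ := h.tail
  rw [IsReduced] at h h₁
  rw [wordProd_cons, List.length_cons] at h
  omega

theorem IsReduced.cons {i : Fin (n - 1)} {ω : List (Fin (n - 1))} (h : IsReduced ω)
    (hlt : length (wordProd ω) < length (simple i * wordProd ω)) : IsReduced (i :: ω) := by
  rw [IsReduced, wordProd_cons, length_simple_mul_of_lt hlt, List.length_cons, h]

theorem IsReduced.reverse {ω : List (Fin (n - 1))} (h : IsReduced ω) : IsReduced ω.reverse := by
  rw [IsReduced, wordProd_reverse, length_inv, List.length_reverse, h]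

theorem isReduced_reducedWord (w : Equiv.Perm (Fin n)) : IsReduced (reducedWord w) := by
  have h := (exists_reducedWord w).choose_spec
  rw [IsReduced, reducedWord, h.1, h.2]

theorem wordProd_reducedWord (w : Equiv.Perm (Fin n)) : wordProd (reducedWord w) = w :=
  (exists_reducedWord w).choose_spec.2

theorem wordMul_stdBasis_one {ω : List (Fin (n - 1))} (h : IsReduced ω) :
    wordMul ω (stdBasis 1) = stdBasis (wordProd ω) := by
  induction ω with
  | nil => rfl
  | cons i ω ih =>
    rw [wordMul_cons, ih h.tail, genMul_stdBasis_of_lt h.lt, wordProd_cons]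

/-- Every `T_w` is obtained from `T_1` by right multiplications along descents, so an endomorphism
commuting with these is determined by its value at `T_1`. -/
theorem linearMap_ext_of_comm_right {f g : Hecke n →ₗ[ℤ[T;T⁻¹]] Hecke n}
    (hf : ∀ j h, f (genMulRight j h) = genMulRight j (f h))
    (hg : ∀ j h, g (genMulRight j h) = genMulRight j (g h))
    (h₁ : f (stdBasis 1) = g (stdBasis 1)) : f = g := by
  refine linearMap_ext_stdBasis fun w => ?_
  induction hm : length w using Nat.strong_induction_on generalizing w with
  | _ m ih =>
  by_cases hw : w = 1
  · rw [hw, h₁]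
  · obtain ⟨i, hi'⟩ : ∃ i : Fin (n - 1), w (hi i) < w (lo i) := by
      by_contra! hcon
      exact hw (eq_one_of_no_descent
        fun i => lt_of_le_of_ne (hcon i) (apply_lo_ne_hi w i))
    have hl := length_mul_simple_of_gt hi'
    have hT : stdBasis w = genMulRight i (stdBasis (w * simple i)) := by
      rw [genMulRight_stdBasis_of_lt, mul_simple_cancel]
      rw [mul_simple_cancel]
      omega
    rw [hT, hf, hg, ih (length (w * simple i)) (by omega) _ rfl]

/-- Independence of the reduced word, without Matsumoto's theorem. The operator `wordInvMul ω`
inverts `wordMul ω.reverse`; the latter commutes with right multiplications and sends `T_1` to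
`T_{w⁻¹}`, which depends on `w` alone. -/
theorem wordInvMul_congr {ω ω' : List (Fin (n - 1))} (h : IsReduced ω) (h' : IsReduced ω')
    (he : wordProd ω = wordProd ω') : wordInvMul ω = wordInvMul ω' := by
  have hrev : wordMul ω.reverse = wordMul ω'.reverse := by
    refine linearMap_ext_of_comm_right (fun j h => wordMul_genMulRight _ j h)
      (fun j h => wordMul_genMulRight _ j h) ?_
    rw [wordMul_stdBasis_one h.reverse, wordMul_stdBasis_one h'.reverse, wordProd_reverse,
      wordProd_reverse, he]
  refine LinearMap.ext fun x => ?_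
  rw [← wordInvMul_wordMul_reverse ω (wordInvMul ω' x), hrev, wordMul_reverse_wordInvMul]

/-! ### The bar involution -/

theorem barBasis_eq_wordInvMul (w : Equiv.Perm (Fin n)) :
    barBasis w = wordInvMul (reducedWord w) (stdBasis 1) := by
  rw [barBasis]
  induction reducedWord w with
  | nil => rfl
  | cons i ω ih => rw [wordInvMul_cons, ← ih, List.map_cons, List.foldr_cons]

theorem barBasis_wordProd {ω : List (Fin (n - 1))} (h : IsReduced ω) :
    barBasis (wordProd ω) = wordInvMul ω (stdBasis 1) := by
  rw [barBasis_eq_wordInvMul,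
    wordInvMul_congr (isReduced_reducedWord _) h (wordProd_reducedWord _)]

theorem barBasis_one : barBasis (1 : Equiv.Perm (Fin n)) = stdBasis 1 :=
  barBasis_wordProd (ω := []) (by simp [IsReduced, wordProd_nil])

theorem barBasis_simple_mul {i : Fin (n - 1)} {w : Equiv.Perm (Fin n)}
    (h : length w < length (simple i * w)) :
    barBasis (simple i * w) = genInvMul i (barBasis w) := by
  have hr := isReduced_reducedWord w
  rw [barBasis_eq_wordInvMul w, ← wordInvMul_cons, ← barBasis_wordProd, wordProd_cons,
    wordProd_reducedWord]
  exact hr.cons (by rwa [wordProd_reducedWord])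

/-! ### Semilinearity of bar and its compatibility with left and right multiplication -/

@[simp] theorem bar_zero : bar (0 : Hecke n) = 0 := Finsupp.sum_zero_index

theorem bar_add (h h' : Hecke n) : bar (h + h') = bar h + bar h' :=
  Finsupp.sum_add_index' (fun w => by rw [map_zero, zero_smul])
    fun w a b => by rw [map_add, add_smul]

theorem bar_smul (a : ℤ[T;T⁻¹]) (h : Hecke n) :
    bar (a • h) = LaurentPolynomial.invert a • bar h := by
  rw [bar, bar, Finsupp.sum_smul_index fun w => by rw [map_zero, zero_smul], Finsupp.smul_sum]
  simp only [map_mul, mul_smul]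

theorem bar_neg (h : Hecke n) : bar (-h) = -bar h := by
  rw [← neg_one_smul ℤ[T;T⁻¹] h, bar_smul, map_neg, map_one, neg_one_smul]

theorem bar_sub (h h' : Hecke n) : bar (h - h') = bar h - bar h' := by
  rw [sub_eq_add_neg, bar_add, bar_neg, ← sub_eq_add_neg]

@[simp] theorem bar_stdBasis (w : Equiv.Perm (Fin n)) : bar (stdBasis w) = barBasis w := by
  rw [bar, stdBasis, Finsupp.sum_single_index (by rw [map_zero, zero_smul]), map_one, one_smul]

theorem hecke_induction {p : Hecke n → Prop} (h : Hecke n) (h₀ : p 0)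
    (hadd : ∀ x y, p x → p y → p (x + y)) (hsmul : ∀ (a : ℤ[T;T⁻¹]) w, p (a • stdBasis w)) :
    p h :=
  Finsupp.induction_linear h h₀ hadd fun w a => by
    simpa [stdBasis] using hsmul a w

theorem bar_genMul_stdBasis (i : Fin (n - 1)) (w : Equiv.Perm (Fin n)) :
    bar (genMul i (stdBasis w)) = genInvMul i (barBasis w) := by
  by_cases h : length w < length (simple i * w)
  · rw [genMul_stdBasis_of_lt h, bar_stdBasis, barBasis_simple_mul h]
  · have h' : length (simple i * w) < length (simple i * (simple i * w)) := by
      rw [simple_mul_cancel, length_simple_mul_of_not_lt h]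
      exact Nat.lt_succ_self _
    have hb := barBasis_simple_mul h'
    rw [simple_mul_cancel] at hb
    rw [genMul_stdBasis_of_not_lt h, bar_add, bar_smul, bar_smul, bar_stdBasis, bar_stdBasis, hb]
    simp only [map_sub, map_one, invert_q, genInvMul_apply, map_add, map_smul, genMul_genMul]
    generalize barBasis (simple i * w) = x
    -- With `x` the bar image of `T_{sw}`, the claim reduces to the quadratic relation for `T_s` and
    -- to `q⁻¹ q = 1`.
    linear_combination (norm := module)
      (-1 : ℤ[T;T⁻¹]) • (qInv_mul_q • (qInv • (genMul i x + x)))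

theorem bar_genMul (i : Fin (n - 1)) (h : Hecke n) :
    bar (genMul i h) = genInvMul i (bar h) := by
  induction h using hecke_induction with
  | h₀ => simp only [map_zero, bar_zero]
  | hadd x y hx hy => rw [map_add, bar_add, bar_add, map_add, hx, hy]
  | hsmul a w =>
    rw [map_smul, bar_smul, bar_smul, map_smul, bar_genMul_stdBasis, bar_stdBasis]

theorem genMul_stdBasis_one (i : Fin (n - 1)) :
    genMul i (stdBasis 1) = stdBasis (simple i) := by
  rw [genMul_stdBasis_of_lt, mul_one]
  rw [length_lt_simple_mul_iff]
  exact lo_lt_hi i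

theorem genMulRight_stdBasis_one (i : Fin (n - 1)) :
    genMulRight i (stdBasis 1) = stdBasis (simple i) := by
  rw [genMulRight_stdBasis_of_lt, one_mul]
  rw [length_lt_mul_simple_iff]
  exact lo_lt_hi i

/-- The left factors are stripped off one by one, since they commute with right multiplication. What
remains is `T_1`, where left and right multiplication by `T_s` coincide. -/
theorem bar_genMulRight_wordMul (j : Fin (n - 1)) (ω : List (Fin (n - 1))) :
    bar (genMulRight j (wordMul ω (stdBasis 1))) =
      genInvMulRight j (bar (wordMul ω (stdBasis 1))) := by
  induction ω with
  | nil =>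
    change bar (genMulRight j (stdBasis 1)) = genInvMulRight j (bar (stdBasis 1))
    rw [genMulRight_stdBasis_one, ← genMul_stdBasis_one, bar_genMul, bar_stdBasis, barBasis_one,
      genInvMul_apply, genInvMulRight_apply, genMul_stdBasis_one, genMulRight_stdBasis_one]
  | cons i ω ih =>
    rw [wordMul_cons, ← genMul_genMulRight, bar_genMul, ih, genInvMul_genInvMulRight, bar_genMul]

theorem bar_genMulRight (j : Fin (n - 1)) (h : Hecke n) :
    bar (genMulRight j h) = genInvMulRight j (bar h) := by
  induction h using hecke_induction with
  | h₀ => simp only [map_zero, bar_zero]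
  | hadd x y hx hy => rw [map_add, bar_add, bar_add, map_add, hx, hy]
  | hsmul a w =>
    rw [map_smul, bar_smul, bar_smul, map_smul]
    have := bar_genMulRight_wordMul j (reducedWord w)
    rw [wordMul_stdBasis_one (isReduced_reducedWord w), wordProd_reducedWord] at this
    rw [this]

/-- Left multiplication by `1 + T_s`. -/
def klMul (i : Fin (n - 1)) : Hecke n →ₗ[ℤ[T;T⁻¹]] Hecke n := LinearMap.id + genMul i

/-- Right multiplication by `1 + T_s`. -/
def klMulRight (i : Fin (n - 1)) : Hecke n →ₗ[ℤ[T;T⁻¹]] Hecke n := LinearMap.id + genMulRight i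

theorem klMul_apply (i : Fin (n - 1)) (h : Hecke n) : klMul i h = h + genMul i h := rfl

theorem klMulRight_apply (i : Fin (n - 1)) (h : Hecke n) :
    klMulRight i h = h + genMulRight i h := rfl

/-- Up to a half power of `q`, `1 + T_s` is the Kazhdan--Lusztig element of `s`. Each such factor
contributes one `q⁻¹` to the eigenvalue, matching an increase of the length by one. -/
theorem bar_klMul (i : Fin (n - 1)) (h : Hecke n) : bar (klMul i h) = qInv • klMul i (bar h) := by
  rw [klMul_apply, bar_add, bar_genMul, genInvMul_apply, klMul_apply]
  module

theorem bar_klMulRight (i : Fin (n - 1)) (h : Hecke n) :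
    bar (klMulRight i h) = qInv • klMulRight i (bar h) := by
  rw [klMulRight_apply, bar_add, bar_genMulRight, genInvMulRight_apply, klMulRight_apply]
  module

/-! ### Uniqueness of Kazhdan--Lusztig polynomials -/

/-- The submodule spanned by the `T_z` with `ℓ(z) < m`. -/
def lowerSpan (n m : ℕ) : Submodule ℤ[T;T⁻¹] (Hecke n) :=
  Finsupp.supported ℤ[T;T⁻¹] ℤ[T;T⁻¹] {z | length z < m}

theorem stdBasis_mem_lowerSpan {m : ℕ} {w : Equiv.Perm (Fin n)} (h : length w < m) :
    stdBasis w ∈ lowerSpan n m :=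
  Finsupp.single_mem_supported _ _ h

theorem apply_eq_zero_of_mem_lowerSpan {m : ℕ} {h : Hecke n} (hh : h ∈ lowerSpan n m)
    {z : Equiv.Perm (Fin n)} (hz : m ≤ length z) : h z = 0 := by
  by_contra hne
  have := (Finsupp.mem_supported _ _).1 hh (Finsupp.mem_support_iff.2 hne)
  exact absurd this (not_lt.2 hz)

theorem lowerSpan_mono {m m' : ℕ} (h : m ≤ m') : lowerSpan n m ≤ lowerSpan n m' :=
  Finsupp.supported_mono fun _ hz => lt_of_lt_of_le hz h

theorem genMul_mem_lowerSpan {m : ℕ} {h : Hecke n} (hh : h ∈ lowerSpan n m) (i : Fin (n - 1)) :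
    genMul i h ∈ lowerSpan n (m + 1) := by
  have hle : lowerSpan n m ≤ (lowerSpan n (m + 1)).comap (genMul i) := by
    rw [lowerSpan, Finsupp.supported_eq_span_single, Submodule.span_le]
    rintro _ ⟨w, hw, rfl⟩
    have hw' : length w < m := hw
    have h₁ : stdBasis w ∈ lowerSpan n (m + 1) := stdBasis_mem_lowerSpan (by omega)
    have h₂ : stdBasis (simple i * w) ∈ lowerSpan n (m + 1) :=
      stdBasis_mem_lowerSpan (by have := length_simple_mul_le i w; omega)
    change genMul i (stdBasis w) ∈ lowerSpan n (m + 1)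
    rw [genMul_stdBasis]
    split_ifs
    · exact h₂
    · exact add_mem (Submodule.smul_mem _ _ h₁) (Submodule.smul_mem _ _ h₂)
  exact hle hh

/-- In each factor `T_s⁻¹ = q⁻¹ T_s + (q⁻¹ - 1)` only `q⁻¹ T_s` can reach the top length; all other
contributions are shorter. -/
theorem wordInvMul_sub_mem_lowerSpan {ω : List (Fin (n - 1))} (h : IsReduced ω) :
    wordInvMul ω (stdBasis 1) - (LaurentPolynomial.T (-(ω.length : ℤ)) : ℤ[T;T⁻¹]) •
      stdBasis (wordProd ω) ∈ lowerSpan n ω.length := by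
  induction ω with
  | nil =>
    change stdBasis 1 - (LaurentPolynomial.T (-((0 : ℕ) : ℤ)) : ℤ[T;T⁻¹]) • stdBasis 1 ∈ _
    simp
  | cons i ω ih =>
    have hlt := h.lt
    have htail := h.tail
    specialize ih htail
    have hT : (LaurentPolynomial.T (-((i :: ω).length : ℤ)) : ℤ[T;T⁻¹]) =
        qInv * LaurentPolynomial.T (-(ω.length : ℤ)) := by
      rw [qInv, ← LaurentPolynomial.T_add, List.length_cons]
      push_cast
      ring_nf
    rw [wordInvMul_cons, wordProd_cons, ← genMul_stdBasis_of_lt hlt, hT]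
    set e := wordInvMul ω (stdBasis 1) -
      (LaurentPolynomial.T (-(ω.length : ℤ)) : ℤ[T;T⁻¹]) • stdBasis (wordProd ω) with he
    rw [eq_add_of_sub_eq he.symm, genInvMul_apply, map_add, map_smul]
    have hw : stdBasis (wordProd ω) ∈ lowerSpan n (i :: ω).length :=
      stdBasis_mem_lowerSpan (by rw [← htail, List.length_cons]; omega)
    have h₁ : genMul i e ∈ lowerSpan n (i :: ω).length := genMul_mem_lowerSpan ih i
    have h₂ : e ∈ lowerSpan n (i :: ω).length := lowerSpan_mono (Nat.le_succ _) ih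
    have h₃ := add_mem (add_mem (Submodule.smul_mem _ qInv h₁) (Submodule.smul_mem _ (qInv - 1) h₂))
      (Submodule.smul_mem _ ((qInv - 1) * LaurentPolynomial.T (-(ω.length : ℤ))) hw)
    convert h₃ using 1
    module

theorem barBasis_sub_mem_lowerSpan (w : Equiv.Perm (Fin n)) :
    barBasis w - (LaurentPolynomial.T (-(length w : ℤ)) : ℤ[T;T⁻¹]) • stdBasis w ∈
      lowerSpan n (length w) := by
  have hr := isReduced_reducedWord w
  have := wordInvMul_sub_mem_lowerSpan hr
  rwa [← barBasis_eq_wordInvMul, hr, wordProd_reducedWord] at this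

theorem barBasis_apply (w z : Equiv.Perm (Fin n)) (h : length w ≤ length z) :
    barBasis w z = if w = z then LaurentPolynomial.T (-(length w : ℤ)) else 0 := by
  have := apply_eq_zero_of_mem_lowerSpan (barBasis_sub_mem_lowerSpan w) h
  rw [Finsupp.sub_apply, sub_eq_zero] at this
  rw [this, Finsupp.smul_apply, stdBasis, Finsupp.single_apply, smul_eq_mul]
  split_ifs <;> simp

/-- By triangularity, at an element of maximal length only its own diagonal term contributes. -/
theorem bar_apply_of_maximal {h : Hecke n} {y : Equiv.Perm (Fin n)}
    (hy : ∀ z, h z ≠ 0 → length z ≤ length y) :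
    bar h y = LaurentPolynomial.invert (h y) * LaurentPolynomial.T (-(length y : ℤ)) := by
  rw [bar, Finsupp.sum_apply, Finsupp.sum]
  have hterm : ∀ z ∈ h.support, (LaurentPolynomial.invert (h z) • barBasis z) y =
      if z = y then LaurentPolynomial.invert (h y) * LaurentPolynomial.T (-(length y : ℤ))
      else 0 := by
    intro z hz
    rw [Finsupp.smul_apply, barBasis_apply z y (hy z (Finsupp.mem_support_iff.1 hz)), smul_eq_mul]
    split_ifs with hzy
    · rw [hzy]
    · rw [mul_zero]
  rw [Finset.sum_congr rfl hterm, Finset.sum_ite_eq']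
  split_ifs with hs
  · rfl
  · rw [Finsupp.notMem_support_iff.1 hs, map_zero, zero_mul]

/-- The element `∑_y P_y T_y` of the Hecke algebra. -/
def heckeOf (P : Equiv.Perm (Fin n) → Polynomial ℤ) : Hecke n :=
  ∑ y, (P y).toLaurent • stdBasis y

theorem heckeOf_apply (P : Equiv.Perm (Fin n) → Polynomial ℤ) (y : Equiv.Perm (Fin n)) :
    heckeOf P y = (P y).toLaurent := by
  rw [heckeOf, Finsupp.finsetSum_apply]
  simp [stdBasis, Finsupp.single_apply]

theorem heckeOf_add (P Q : Equiv.Perm (Fin n) → Polynomial ℤ) :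
    heckeOf (P + Q) = heckeOf P + heckeOf Q := by
  simp [heckeOf, add_smul, Finset.sum_add_distrib]

theorem heckeOf_neg (P : Equiv.Perm (Fin n) → Polynomial ℤ) :
    heckeOf (-P) = -heckeOf P := by
  simp [heckeOf]

theorem heckeOf_single (y : Equiv.Perm (Fin n)) (p : Polynomial ℤ) :
    heckeOf (Pi.single y p) = p.toLaurent • stdBasis y := by
  rw [heckeOf, Finset.sum_eq_single y]
  · rw [Pi.single_eq_same]
  · intro z _ hz
    rw [Pi.single_eq_of_ne hz, map_zero, zero_smul]
  · simp

/-- The coefficientwise form of the degree bound is the one that passes to sums and differences. -/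
theorem two_mul_natDegree_add_le_iff {p : Polynomial ℤ} {a b : ℕ} :
    (p ≠ 0 → 2 * p.natDegree + a + 1 ≤ b) ↔ ∀ d, p.coeff d ≠ 0 → 2 * d + a + 1 ≤ b := by
  constructor
  · intro h d hd
    have h₁ := Polynomial.le_natDegree_of_ne_zero hd
    have h₂ := h (by rintro rfl; simp at hd)
    omega
  · intro h hp
    exact h _ (Polynomial.leadingCoeff_ne_zero.2 hp)

/-- All monomials of `q^m p(q⁻¹)` have degree at least `m - deg p`, which exceeds `deg p`. -/
theorem eq_zero_of_invert_mul_T {p : Polynomial ℤ} {m : ℕ}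
    (h : LaurentPolynomial.invert p.toLaurent * LaurentPolynomial.T m = p.toLaurent)
    (hd : p ≠ 0 → 2 * p.natDegree + 1 ≤ m) : p = 0 := by
  by_contra hp
  specialize hd hp
  have hrev : p.reverse * Polynomial.X ^ (m - p.natDegree) = p := by
    rw [← Polynomial.toLaurent_inj, map_mul, LaurentPolynomial.toLaurent_reverse,
      Polynomial.toLaurent_X_pow, LaurentPolynomial.mul_T_assoc]
    convert h using 3
    omega
  have hne : p.reverse ≠ 0 := Polynomial.reverse_eq_zero.not.2 hp
  have := congrArg Polynomial.natDegree hrev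
  rw [Polynomial.natDegree_mul_X_pow _ hne] at this
  omega

/-- Comparing coefficients at an element `y` of maximal length in the support gives `q^(ℓ(w) - ℓ(y))
D_y(q⁻¹) = D_y(q)`, which the degree bound forbids for `D_y ≠ 0`. -/
theorem eq_zero_of_bar_heckeOf {w : Equiv.Perm (Fin n)}
    {D : Equiv.Perm (Fin n) → Polynomial ℤ}
    (hdeg : ∀ y, D y ≠ 0 → 2 * (D y).natDegree + length y + 1 ≤ length w)
    (hbar : bar (heckeOf D) = (LaurentPolynomial.T (-(length w : ℤ)) : ℤ[T;T⁻¹]) • heckeOf D) :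
    D = 0 := by
  by_contra hD
  obtain ⟨y₀, hy₀⟩ := Function.ne_iff.1 hD
  obtain ⟨y, hy, hmax⟩ := Finset.exists_max_image
    (Finset.univ.filter fun y => D y ≠ 0) length ⟨y₀, by simpa using hy₀⟩
  simp only [Finset.mem_filter, Finset.mem_univ, true_and] at hy hmax
  have hb := bar_apply_of_maximal (h := heckeOf D) (y := y) fun z hz => hmax z (by
    rw [heckeOf_apply] at hz
    exact Polynomial.toLaurent_ne_zero.1 hz)
  rw [hbar, Finsupp.smul_apply, heckeOf_apply, smul_eq_mul] at hb
  have hd := hdeg y hy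
  refine hy (eq_zero_of_invert_mul_T (m := length w - length y) ?_ fun _ => by omega)
  have hb' := congrArg (LaurentPolynomial.T (length w : ℤ) * ·) hb
  simp only [← mul_assoc, ← LaurentPolynomial.T_add, add_neg_cancel, LaurentPolynomial.T_zero,
    one_mul] at hb'
  refine Eq.trans ?_ hb'.symm
  rw [LaurentPolynomial.T_mul, mul_assoc, ← LaurentPolynomial.T_add]
  congr 2
  omega

theorem IsKLFamily.unique {w : Equiv.Perm (Fin n)} {P Q : Equiv.Perm (Fin n) → Polynomial ℤ}
    (hP : IsKLFamily w P) (hQ : IsKLFamily w Q) : P = Q := by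
  obtain ⟨hP₁, hP₂, hP₃⟩ := hP
  obtain ⟨hQ₁, hQ₂, hQ₃⟩ := hQ
  rw [← sub_eq_zero]
  refine eq_zero_of_bar_heckeOf (w := w) (fun y => ?_) ?_
  · by_cases hy : y = w
    · intro h
      rw [hy, Pi.sub_apply, hP₁, hQ₁, sub_self] at h
      exact absurd rfl h
    · rw [two_mul_natDegree_add_le_iff]
      intro d hd
      rw [Pi.sub_apply, Polynomial.coeff_sub] at hd
      by_cases hPd : (P y).coeff d = 0
      · exact two_mul_natDegree_add_le_iff.1 (hQ₂ y hy) d fun h => hd (by rw [hPd, h, sub_zero])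
      · exact two_mul_natDegree_add_le_iff.1 (hP₂ y hy) d hPd
  · change bar (heckeOf P) = _ • heckeOf P at hP₃
    change bar (heckeOf Q) = _ • heckeOf Q at hQ₃
    rw [sub_eq_add_neg, heckeOf_add, heckeOf_neg, ← sub_eq_add_neg, bar_sub, hP₃, hQ₃, smul_sub]

theorem IsKLFamily.klPoly_eq {w : Equiv.Perm (Fin n)} {P : Equiv.Perm (Fin n) → Polynomial ℤ}
    (hP : IsKLFamily w P) (y : Equiv.Perm (Fin n)) : klPoly y w = P y := by
  have h : ∃ P, IsKLFamily w P := ⟨P, hP⟩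
  rw [klPoly, dif_pos h, h.choose_spec.unique hP]

/-! ### Kazhdan--Lusztig elements -/

/-- The additive group generated by the `q^d T_y` with `C d y`. -/
def monomialSpan (C : ℕ → Equiv.Perm (Fin n) → Prop) : AddSubgroup (Hecke n) :=
  AddSubgroup.closure
    {h | ∃ d y, C d y ∧ h = (LaurentPolynomial.T (d : ℤ) : ℤ[T;T⁻¹]) • stdBasis y}

theorem T_smul_mem_monomialSpan {C : ℕ → Equiv.Perm (Fin n) → Prop} {d : ℕ}
    {y : Equiv.Perm (Fin n)} (h : C d y) :
    (LaurentPolynomial.T (d : ℤ) : ℤ[T;T⁻¹]) • stdBasis y ∈ monomialSpan C :=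
  AddSubgroup.subset_closure ⟨d, y, h, rfl⟩

theorem stdBasis_mem_monomialSpan {C : ℕ → Equiv.Perm (Fin n) → Prop}
    {y : Equiv.Perm (Fin n)} (h : C 0 y) : stdBasis y ∈ monomialSpan C := by
  simpa using T_smul_mem_monomialSpan h

theorem monomialSpan_mono {C C' : ℕ → Equiv.Perm (Fin n) → Prop} (h : ∀ d y, C d y → C' d y) :
    monomialSpan C ≤ monomialSpan C' :=
  AddSubgroup.closure_mono fun _ ⟨d, y, hd, he⟩ => ⟨d, y, h d y hd, he⟩

theorem exists_heckeOf_of_mem_monomialSpan {C : ℕ → Equiv.Perm (Fin n) → Prop} {h : Hecke n}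
    (hh : h ∈ monomialSpan C) :
    ∃ Q : Equiv.Perm (Fin n) → Polynomial ℤ,
      heckeOf Q = h ∧ ∀ y d, (Q y).coeff d ≠ 0 → C d y := by
  induction hh using AddSubgroup.closure_induction with
  | mem x hx =>
    obtain ⟨d, y, hC, rfl⟩ := hx
    refine ⟨Pi.single y (Polynomial.X ^ d), ?_, fun z e hz => ?_⟩
    · rw [heckeOf_single, Polynomial.toLaurent_X_pow]
    · by_cases hzy : z = y
      · subst hzy
        rw [Pi.single_eq_same, Polynomial.coeff_X_pow] at hz
        rw [(ite_ne_right_iff.1 hz).1]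
        exact hC
      · rw [Pi.single_eq_of_ne hzy, Polynomial.coeff_zero] at hz
        exact absurd rfl hz
  | zero => exact ⟨0, by simp [heckeOf], by simp⟩
  | add x y _ _ hx hy =>
    obtain ⟨P, rfl, hP⟩ := hx
    obtain ⟨Q, rfl, hQ⟩ := hy
    refine ⟨P + Q, heckeOf_add P Q, fun z d hz => ?_⟩
    by_cases hPz : (P z).coeff d = 0
    · refine hQ z d fun hQz => hz ?_
      rw [Pi.add_apply, Polynomial.coeff_add, hPz, hQz, add_zero]
    · exact hP z d hPz
  | neg x _ hx =>
    obtain ⟨P, rfl, hP⟩ := hx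
    exact ⟨-P, heckeOf_neg P, fun z d hz => hP z d (by simpa using hz)⟩

/-- A bar invariant element whose lower coefficients satisfy the degree bounds has the
Kazhdan--Lusztig polynomials as coefficients. -/
theorem toLaurent_klPoly_eq {w : Equiv.Perm (Fin n)} {E : Hecke n}
    (hE : E ∈ monomialSpan fun d y => 2 * d + length y + 1 ≤ length w)
    (hbar : bar (stdBasis w + E) =
      (LaurentPolynomial.T (-(length w : ℤ)) : ℤ[T;T⁻¹]) • (stdBasis w + E))
    (y : Equiv.Perm (Fin n)) : (klPoly y w).toLaurent = (stdBasis w + E) y := by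
  obtain ⟨Q, rfl, hQ⟩ := exists_heckeOf_of_mem_monomialSpan hE
  have hsum : heckeOf (Pi.single w 1 + Q) = stdBasis w + heckeOf Q := by
    rw [heckeOf_add, heckeOf_single, map_one, one_smul]
  have hfam : IsKLFamily w (Pi.single w 1 + Q) := by
    refine ⟨?_, fun y hy => ?_, ?_⟩
    · have hw : Q w = 0 := by
        ext d
        by_contra hd
        have := hQ w d hd
        omega
      rw [Pi.add_apply, Pi.single_eq_same, hw, add_zero]
    · rw [Pi.add_apply, Pi.single_eq_of_ne hy, zero_add, two_mul_natDegree_add_le_iff]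
      exact hQ y
    · change bar (heckeOf _) = _ • heckeOf _
      rw [hsum, hbar]
  rw [hfam.klPoly_eq, ← heckeOf_apply, hsum]

theorem klPoly_one_one : klPoly 1 (1 : Equiv.Perm (Fin n)) = 1 := by
  rw [← Polynomial.toLaurent_inj, toLaurent_klPoly_eq (E := 0) (zero_mem _)]
  · simp [stdBasis]
  · simp [barBasis_one]

/-! ### Multiplying by `1 + T_s` on both sides -/

theorem hi_le_of_lo_lt {i : Fin (n - 1)} {x : Fin n} (h : lo i < x) : hi i ≤ x := by
  simp only [lo, hi, Fin.lt_def, Fin.le_def] at *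
  omega

theorem simple_apply_of_lt_lo {i : Fin (n - 1)} {x : Fin n} (h : x < lo i) : simple i x = x :=
  Equiv.swap_apply_of_ne_of_ne h.ne (h.trans (lo_lt_hi i)).ne

theorem simple_apply_of_hi_lt {i : Fin (n - 1)} {x : Fin n} (h : hi i < x) : simple i x = x :=
  Equiv.swap_apply_of_ne_of_ne ((lo_lt_hi i).trans h).ne' h.ne'

theorem inv_apply_eq_self {y : Equiv.Perm (Fin n)} {x : Fin n} (h : y x = x) : y⁻¹ x = x := by
  rw [Equiv.Perm.inv_eq_iff_eq, h]

/-! ### The product `(1 + T_s) T_y (1 + T_s)` for `y` fixing all letters below `hi i` -/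

section Step

variable {i : Fin (n - 1)} {y : Equiv.Perm (Fin n)}

theorem lo_lt_apply_hi (hy : ∀ x < hi i, y x = x) : lo i < y (hi i) := by
  by_contra! h
  have h₁ := hy _ (h.trans_lt (lo_lt_hi i))
  have h₂ := y.injective h₁
  rw [h₂] at h
  exact absurd h (not_le.2 (lo_lt_hi i))

theorem apply_lo_eq (hy : ∀ x < hi i, y x = x) : y (lo i) = lo i := hy _ (lo_lt_hi i)

theorem length_lt_mul_simple_of_fix (hy : ∀ x < hi i, y x = x) :
    length y < length (y * simple i) := by
  rw [length_lt_mul_simple_iff, apply_lo_eq hy]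
  exact lo_lt_apply_hi hy

theorem inv_fix (hy : ∀ x < hi i, y x = x) : ∀ x < hi i, y⁻¹ x = x := fun x hx =>
  inv_apply_eq_self (hy x hx)

theorem length_lt_simple_mul_of_fix (hy : ∀ x < hi i, y x = x) :
    length y < length (simple i * y) := by
  rw [length_lt_simple_mul_iff, apply_lo_eq (inv_fix hy)]
  exact lo_lt_apply_hi (inv_fix hy)

theorem length_mul_simple_of_fix (hy : ∀ x < hi i, y x = x) :
    length (y * simple i) = length y + 1 :=
  length_mul_simple (length_lt_mul_simple_iff.1 (length_lt_mul_simple_of_fix hy))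

theorem length_simple_mul_of_fix (hy : ∀ x < hi i, y x = x) :
    length (simple i * y) = length y + 1 :=
  length_simple_mul_of_lt (length_lt_simple_mul_of_fix hy)

theorem length_lt_simple_mul_mul_simple (hy : ∀ x < hi i, y x = x) (hne : y (hi i) ≠ hi i) :
    length (y * simple i) < length (simple i * (y * simple i)) := by
  rw [length_lt_simple_mul_iff, mul_inv_rev, simple_inv, Equiv.Perm.mul_apply,
    Equiv.Perm.mul_apply, apply_lo_eq (inv_fix hy), simple_lo]
  have hlt : hi i < y⁻¹ (hi i) := by
    refine lt_of_le_of_ne (hi_le_of_lo_lt (lo_lt_apply_hi (inv_fix hy))) fun h => hne ?_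
    rw [eq_comm, ← Equiv.Perm.inv_eq_iff_eq, ← h]
  rwa [simple_apply_of_hi_lt hlt]

theorem length_simple_mul_mul_simple (hy : ∀ x < hi i, y x = x) (hne : y (hi i) ≠ hi i) :
    length (simple i * (y * simple i)) = length y + 2 := by
  rw [length_simple_mul_of_lt (length_lt_simple_mul_mul_simple hy hne),
    length_mul_simple_of_fix hy]

theorem mul_simple_eq_simple_mul (hy : ∀ x < hi i, y x = x) (he : y (hi i) = hi i) :
    y * simple i = simple i * y := by
  rw [simple_eq_swap, Equiv.mul_swap_eq_swap_mul, apply_lo_eq hy, he]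

theorem klMul_klMulRight_of_fix (hy : ∀ x < hi i, y x = x) (he : y (hi i) = hi i) :
    klMul i (klMulRight i (stdBasis y)) =
      stdBasis y + q • stdBasis y + (stdBasis (simple i * y) + q • stdBasis (simple i * y)) := by
  have hc := mul_simple_eq_simple_mul hy he
  have hlt := length_lt_simple_mul_of_fix hy
  have hlt' : ¬length (simple i * y) < length (simple i * (simple i * y)) := by
    rw [simple_mul_cancel]
    exact hlt.not_gt
  rw [klMulRight_apply, genMulRight_stdBasis_of_lt (length_lt_mul_simple_of_fix hy), hc,
    klMul_apply, map_add, genMul_stdBasis_of_lt hlt, genMul_stdBasis_of_not_lt hlt',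
    simple_mul_cancel]
  module

theorem klMul_klMulRight_of_not_fix (hy : ∀ x < hi i, y x = x) (hne : y (hi i) ≠ hi i) :
    klMul i (klMulRight i (stdBasis y)) =
      stdBasis (simple i * (y * simple i)) +
        (stdBasis y + stdBasis (y * simple i) + stdBasis (simple i * y)) := by
  rw [klMulRight_apply, genMulRight_stdBasis_of_lt (length_lt_mul_simple_of_fix hy),
    klMul_apply, map_add, genMul_stdBasis_of_lt (length_lt_simple_mul_of_fix hy),
    genMul_stdBasis_of_lt (length_lt_simple_mul_mul_simple hy hne)]
  module

/-- As `y` fixes `lo i`, it differs from `s`, so `T_1` can arise only from `y = 1`, where the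
product is `(1 + q)(1 + T_s)`. -/
theorem klMul_klMulRight_stdBasis_apply_one (hy : ∀ x < hi i, y x = x) :
    klMul i (klMulRight i (stdBasis y)) 1 = (1 + q) * stdBasis y 1 := by
  have hlo := apply_lo_eq hy
  have hs : y ≠ simple i := by
    rintro rfl
    rw [simple_lo] at hlo
    exact (lo_lt_hi i).ne' hlo
  have h₁ : simple i * y ≠ 1 := fun h => hs (by
    rw [← simple_mul_cancel i y, h, mul_one])
  by_cases he : y (hi i) = hi i
  · rw [klMul_klMulRight_of_fix hy he]
    simp only [stdBasis, Finsupp.add_apply, Finsupp.smul_apply, Finsupp.single_apply, h₁,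
      smul_eq_mul, if_false]
    ring
  · have h₂ : y * simple i ≠ 1 := fun h => hs (by
      rw [← mul_simple_cancel i y, h, one_mul])
    have h₃ : y ≠ 1 := by
      rintro rfl
      exact he rfl
    have h₄ : simple i * (y * simple i) ≠ 1 := fun h => h₃ (by
      rw [← mul_simple_cancel i y, ← simple_mul_cancel i (y * simple i), h, mul_one,
        simple_mul_self])
    rw [klMul_klMulRight_of_not_fix hy he]
    simp [stdBasis, h₁, h₂, h₃, h₄]

end Step

/-- The bound on the terms `q^d T_y` of the Kazhdan--Lusztig element of a permutation of length
`N` fixing all letters below `a`; it is sharpened by one for those `y` which also fix `a`. -/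
def TermBound (a : Fin n) (N d : ℕ) (y : Equiv.Perm (Fin n)) : Prop :=
  (∀ x < a, y x = x) ∧ 2 * d + length y + 1 ≤ N ∧ (y a = a → 2 * d + length y + 2 ≤ N)

/-- If `y` fixes `hi i`, the worst term is `q^(d+1) T_{sy}`, for which `2(d+1) + (ℓ(y)+1) + 1 ≤ N +
2` is exactly the sharpened bound. Otherwise the worst term `q^d T_{sys}` needs only the plain
bound. All new terms that fix `lo i` are multiples of `T_y`, short enough to satisfy the sharpened
bound again. -/
theorem klMul_klMulRight_mem {i : Fin (n - 1)} {N : ℕ} {h : Hecke n}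
    (hh : h ∈ monomialSpan (TermBound (hi i) N)) :
    klMul i (klMulRight i h) ∈ monomialSpan (TermBound (lo i) (N + 2)) ∧
      klMul i (klMulRight i h) 1 = (1 + q) * h 1 := by
  induction hh using AddSubgroup.closure_induction with
  | zero => simp
  | add x y _ _ hx hy =>
    rw [map_add, map_add]
    refine ⟨add_mem hx.1 hy.1, ?_⟩
    rw [Finsupp.add_apply, hx.2, hy.2, Finsupp.add_apply, mul_add]
  | neg x _ hx =>
    rw [map_neg, map_neg]
    refine ⟨neg_mem hx.1, ?_⟩
    rw [Finsupp.neg_apply, hx.2, Finsupp.neg_apply, mul_neg]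
  | mem x hx =>
    obtain ⟨d, y, ⟨hy, h₁, h₂⟩, rfl⟩ := hx
    rw [map_smul, map_smul]
    refine ⟨?_, by
      rw [Finsupp.smul_apply, Finsupp.smul_apply, klMul_klMulRight_stdBasis_apply_one hy,
        smul_eq_mul, smul_eq_mul, mul_left_comm]⟩
    have hfix : ∀ x < lo i, y x = x := fun x hx => hy x (hx.trans (lo_lt_hi i))
    have hsy : ∀ x < lo i, (simple i * y) x = x := fun x hx => by
      rw [Equiv.Perm.mul_apply, hfix x hx, simple_apply_of_lt_lo hx]
    have hys : ∀ x < lo i, (y * simple i) x = x := fun x hx => by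
      rw [Equiv.Perm.mul_apply, simple_apply_of_lt_lo hx, hfix x hx]
    have hsys : ∀ x < lo i, (simple i * (y * simple i)) x = x := fun x hx => by
      rw [Equiv.Perm.mul_apply, hys x hx, simple_apply_of_lt_lo hx]
    have hsy' : (simple i * y) (lo i) ≠ lo i := by
      rw [Equiv.Perm.mul_apply, apply_lo_eq hy, simple_lo]
      exact (lo_lt_hi i).ne'
    have hl₁ := length_simple_mul_of_fix hy
    have hl₂ := length_mul_simple_of_fix hy
    have hq : ∀ z : Equiv.Perm (Fin n), (LaurentPolynomial.T (d : ℤ) : ℤ[T;T⁻¹]) •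
        q • stdBasis z =
        (LaurentPolynomial.T ((d + 1 : ℕ) : ℤ) : ℤ[T;T⁻¹]) • stdBasis z := fun z => by
      rw [smul_smul, q, ← LaurentPolynomial.T_add]
      push_cast
      rfl
    by_cases he : y (hi i) = hi i
    · have h₃ := h₂ he
      rw [klMul_klMulRight_of_fix hy he]
      simp only [smul_add, hq]
      refine add_mem (add_mem ?_ ?_) (add_mem ?_ ?_) <;> apply T_smul_mem_monomialSpan
      · exact ⟨hfix, by omega, fun _ => by omega⟩
      · exact ⟨hfix, by omega, fun _ => by omega⟩
      · exact ⟨hsy, by omega, fun h => absurd h hsy'⟩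
      · exact ⟨hsy, by omega, fun h => absurd h hsy'⟩
    · have hl₃ := length_simple_mul_mul_simple hy he
      rw [klMul_klMulRight_of_not_fix hy he]
      simp only [smul_add]
      refine add_mem ?_ (add_mem (add_mem ?_ ?_) ?_) <;> apply T_smul_mem_monomialSpan
      · refine ⟨hsys, by omega, fun h => absurd h ?_⟩
        rw [Equiv.Perm.mul_apply, Equiv.Perm.mul_apply, simple_lo]
        have hlt : hi i < y (hi i) :=
          lt_of_le_of_ne (hi_le_of_lo_lt (lo_lt_apply_hi hy)) (Ne.symm he)
        rw [simple_apply_of_hi_lt hlt]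
        exact ((lo_lt_hi i).trans hlt).ne'
      · exact ⟨hfix, by omega, fun _ => by omega⟩
      · refine ⟨hys, by omega, fun h => absurd h ?_⟩
        rw [Equiv.Perm.mul_apply, simple_lo]
        exact (lo_lt_apply_hi hy).ne'
      · exact ⟨hsy, by omega, fun h => absurd h hsy'⟩

/-! ### The Kazhdan--Lusztig element of a transposition `(a, n)` -/

theorem simple_mul_swap_mul_simple {i : Fin (n - 1)} {e : Fin n} (he : hi i < e) :
    simple i * (Equiv.swap (hi i) e * simple i) = Equiv.swap (lo i) e := by
  have h := Equiv.mul_swap_eq_swap_mul (simple i) (hi i) e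
  rw [simple_hi, simple_apply_of_hi_lt he] at h
  rw [← mul_assoc, h, mul_simple_cancel]

theorem swap_apply_of_lt {a e x : Fin n} (hae : a < e) (hx : x < a) : Equiv.swap a e x = x :=
  Equiv.swap_apply_of_ne_of_ne hx.ne (hx.trans hae).ne

theorem length_simple (i : Fin (n - 1)) : length (simple i) = 1 := by
  have := length_mul_simple (w := 1) (i := i) (lo_lt_hi i)
  rwa [one_mul, length_one] at this

/-- `m` counts the factors `1 + q` of the coefficient of `T_1` in the Kazhdan--Lusztig element of
the transposition `(a, e)`. -/
def HasTranspositionElement (a e : Fin n) (m : ℕ) : Prop :=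
  ∃ E ∈ monomialSpan (TermBound a (length (Equiv.swap a e))),
    bar (stdBasis (Equiv.swap a e) + E) =
      (LaurentPolynomial.T (-(length (Equiv.swap a e) : ℤ)) : ℤ[T;T⁻¹]) •
        (stdBasis (Equiv.swap a e) + E) ∧
    (stdBasis (Equiv.swap a e) + E) 1 = (1 + q) ^ m

theorem HasTranspositionElement.lo_of_hi {i : Fin (n - 1)} {e : Fin n} {m : ℕ} (he : hi i < e)
    (h : HasTranspositionElement (hi i) e m) : HasTranspositionElement (lo i) e (m + 1) := by
  obtain ⟨E, hE, hbar, hone⟩ := h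
  have hy : ∀ x < hi i, Equiv.swap (hi i) e x = x := fun x hx => swap_apply_of_lt he hx
  have hne : Equiv.swap (hi i) e (hi i) ≠ hi i := by
    rw [Equiv.swap_apply_left]
    exact he.ne'
  have hfix : ∀ x < lo i, Equiv.swap (hi i) e x = x := fun x hx => hy x (hx.trans (lo_lt_hi i))
  have hlen := length_simple_mul_mul_simple hy hne
  have hl₁ := length_simple_mul_of_fix hy
  have hl₂ := length_mul_simple_of_fix hy
  have hX := klMul_klMulRight_of_not_fix hy hne
  have hX₁ := klMul_klMulRight_stdBasis_apply_one hy
  rw [simple_mul_swap_mul_simple he] at hlen hX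
  obtain ⟨hE₁, hE₂⟩ := klMul_klMulRight_mem hE
  have hsplit : ∀ a b c : Hecke n, a + (b + c) = a + b + c := fun a b c => (add_assoc a b c).symm
  -- The lower terms of `(1 + T_s)(T_t + E)(1 + T_s)` with `t = (hi i, e)`; its leading term is
  -- `T_{sts}`.
  refine ⟨stdBasis (Equiv.swap (hi i) e) + stdBasis (Equiv.swap (hi i) e * simple i) +
    stdBasis (simple i * Equiv.swap (hi i) e) + klMul i (klMulRight i E), ?_, ?_, ?_⟩
  · rw [hlen]
    refine add_mem (add_mem (add_mem ?_ ?_) ?_) hE₁ <;> apply stdBasis_mem_monomialSpan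
    · exact ⟨hfix, by omega, fun _ => by omega⟩
    · refine ⟨fun x hx => ?_, by omega, fun h => absurd h ?_⟩
      · rw [Equiv.Perm.mul_apply, simple_apply_of_lt_lo hx, hfix x hx]
      · rw [Equiv.Perm.mul_apply, simple_lo]
        exact (lo_lt_apply_hi hy).ne'
    · refine ⟨fun x hx => ?_, by omega, fun h => absurd h ?_⟩
      · rw [Equiv.Perm.mul_apply, hfix x hx, simple_apply_of_lt_lo hx]
      · rw [Equiv.Perm.mul_apply, apply_lo_eq hy, simple_lo]
        exact (lo_lt_hi i).ne'
  · rw [hsplit, ← hX, ← map_add, ← map_add, bar_klMul, bar_klMulRight, hbar, map_smul, map_smul,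
      map_smul, smul_smul, smul_smul, hlen]
    congr 1
    rw [qInv, ← LaurentPolynomial.T_add, ← LaurentPolynomial.T_add]
    push_cast
    ring_nf
  · rw [hsplit, ← hX, Finsupp.add_apply, hX₁, hE₂, ← mul_add, ← Finsupp.add_apply, hone, pow_succ']

/-- The induction cannot start from a simple transposition: in `1 + T_{s'}` the term `T_1` violates
the sharpened bound. One step from there produces the excess `q (1 + T_s)`, which is subtracted. -/
theorem hasTranspositionElement_adjacent {i i' : Fin (n - 1)} (hii : lo i' = hi i) :
    HasTranspositionElement (lo i) (hi i') 0 := by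
  have he : hi i < hi i' := hii ▸ lo_lt_hi i'
  have hs' : simple i' = Equiv.swap (hi i) (hi i') := by rw [simple_eq_swap, hii]
  have hy : ∀ x < hi i, simple i' x = x := fun x hx => simple_apply_of_lt_lo (hii ▸ hx)
  have hne : simple i' (hi i) ≠ hi i := by
    rw [hs', Equiv.swap_apply_left]
    exact he.ne'
  have hfix : ∀ x < lo i, simple i' x = x := fun x hx => hy x (hx.trans (lo_lt_hi i))
  have hlen := length_simple_mul_mul_simple hy hne
  have hl₁ := length_simple_mul_of_fix hy
  have hl₂ := length_mul_simple_of_fix hy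
  have hX := klMul_klMulRight_of_not_fix hy hne
  have hX₁ := klMul_klMulRight_stdBasis_apply_one hy
  have hO := klMul_klMulRight_of_fix (i := i) (y := 1) (fun _ _ => rfl) rfl
  have hconj : simple i * (simple i' * simple i) = Equiv.swap (lo i) (hi i') := by
    rw [hs', simple_mul_swap_mul_simple he]
  rw [hconj] at hlen hX
  rw [length_simple] at hlen hl₁ hl₂
  have hi₁ := length_simple i
  have hi₂ := length_simple i'
  have hkl : ∀ j : Fin (n - 1), klMul j (stdBasis 1) = stdBasis 1 + stdBasis (simple j) :=
    fun j => by rw [klMul_apply, genMul_stdBasis_one]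
  rw [mul_one] at hO
  have hsum : stdBasis (Equiv.swap (lo i) (hi i')) + (stdBasis (simple i') +
      stdBasis (simple i' * simple i) + stdBasis (simple i * simple i') +
      (stdBasis 1 + stdBasis (simple i))) =
      klMul i (klMulRight i (klMul i' (stdBasis 1))) - q • klMul i (stdBasis 1) := by
    rw [hkl, hkl, map_add, map_add, hX, hO]
    module
  refine ⟨stdBasis (simple i') + stdBasis (simple i' * simple i) +
    stdBasis (simple i * simple i') + (stdBasis 1 + stdBasis (simple i)), ?_, ?_, ?_⟩
  · rw [hlen]
    refine add_mem (add_mem (add_mem ?_ ?_) ?_) (add_mem ?_ ?_) <;>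
      apply stdBasis_mem_monomialSpan
    · exact ⟨hfix, by omega, fun _ => by omega⟩
    · refine ⟨fun x hx => ?_, by omega, fun h => absurd h ?_⟩
      · rw [Equiv.Perm.mul_apply, simple_apply_of_lt_lo hx, hfix x hx]
      · rw [Equiv.Perm.mul_apply, simple_lo]
        exact (lo_lt_apply_hi hy).ne'
    · refine ⟨fun x hx => ?_, by omega, fun h => absurd h ?_⟩
      · rw [Equiv.Perm.mul_apply, hfix x hx, simple_apply_of_lt_lo hx]
      · rw [Equiv.Perm.mul_apply, apply_lo_eq hy, simple_lo]
        exact (lo_lt_hi i).ne'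
    · exact ⟨fun _ _ => rfl, by rw [length_one]; omega, fun _ => by rw [length_one]; omega⟩
    · exact ⟨fun x hx => simple_apply_of_lt_lo hx, by omega, fun _ => by omega⟩
  · have hT : (LaurentPolynomial.T (-(length (Equiv.swap (lo i) (hi i')) : ℤ)) : ℤ[T;T⁻¹]) =
        qInv * qInv * qInv := by
      rw [hlen, qInv, ← LaurentPolynomial.T_add, ← LaurentPolynomial.T_add]
      rfl
    rw [hsum, hT, bar_sub, bar_smul, bar_klMul, bar_klMulRight, bar_klMul, bar_klMul,
      bar_stdBasis, barBasis_one, invert_q, map_smul, map_smul, map_smul]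
    linear_combination (norm := module) (qInv * qInv) • qInv_mul_q • klMul i (stdBasis 1 : Hecke n)
  · have hs₁ : simple i ≠ 1 := fun h => by rw [h, length_one] at hi₁; omega
    have hs₂ : simple i' ≠ 1 := fun h => by rw [h, length_one] at hi₂; omega
    -- The coefficient of `T_1` is `(1 + q) - q = 1`, hence the exponent `0`.
    rw [hsum, hkl, map_add, map_add, Finsupp.sub_apply, Finsupp.add_apply, hX₁,
      klMul_klMulRight_stdBasis_apply_one (fun _ _ => rfl), hkl]
    simp [stdBasis, hs₁, hs₂]

theorem hasTranspositionElement (e : Fin n) (he : (e : ℕ) + 1 = n) (m : ℕ) (i : Fin (n - 1))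
    (hm : (i : ℕ) + m + 3 = n) : HasTranspositionElement (lo i) e m := by
  induction m generalizing i with
  | zero =>
    have := hasTranspositionElement_adjacent (i := i) (i' := ⟨i + 1, by omega⟩) rfl
    convert this using 1
    apply Fin.ext
    simp only [hi]
    omega
  | succ m ih =>
    exact (ih ⟨i + 1, by omega⟩ (by simp only; omega)).lo_of_hi (i := i) (by
      rw [Fin.lt_def]
      simp only [hi]
      omega)

theorem klPoly_one_swap {a e : Fin n} {m : ℕ} (h : HasTranspositionElement a e m) :
    klPoly 1 (Equiv.swap a e) = (1 + Polynomial.X) ^ m := by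
  obtain ⟨E, hE, hbar, hone⟩ := h
  rw [← Polynomial.toLaurent_inj,
    toLaurent_klPoly_eq (monomialSpan_mono (fun d y hy => hy.2.1) hE) hbar, hone]
  simp [q]

/-! ### The product formula for `l = 0` and `l = 1` -/

theorem uPerm_apply_val {k l : ℕ} (x : Fin (k + 2 * l)) :
    (uPerm k l x : ℕ) =
      if (x : ℕ) < l then x + (k + l) else if (x : ℕ) < l + k then (x : ℕ) else x - (k + l) := rfl

theorem flankPerm_apply_val {k l : ℕ} (x : Fin (k + 2 * l)) :
    (flankPerm k l x : ℕ) =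
      if (x : ℕ) < l then l - 1 - x
      else if (x : ℕ) < l + k then (x : ℕ) else (l + k) + (k + 2 * l - 1 - x) := rfl

theorem wPerm_zero (k : ℕ) : wPerm k 0 = 1 := by
  ext x
  have hx := x.isLt
  rw [wPerm, Equiv.Perm.mul_apply, flankPerm_apply_val, uPerm_apply_val, Equiv.Perm.one_apply]
  split_ifs <;> omega

theorem wPerm_one (k : ℕ) : wPerm k 1 = Equiv.swap ⟨0, by omega⟩ ⟨k + 1, by omega⟩ := by
  ext x
  have hx := x.isLt
  rw [wPerm, Equiv.Perm.mul_apply, flankPerm_apply_val, uPerm_apply_val, Equiv.swap_apply_def]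
  simp only [Fin.ext_iff, apply_ite Fin.val]
  split_ifs <;> omega

theorem productFormula_zero : ProductFormula 0 := by
  intro k _
  rw [wPerm_zero, klPoly_one_one]
  simp

theorem productFormula_one : ProductFormula 1 := by
  intro k hk
  rw [wPerm_one]
  -- Of the `k` letters strictly between the two exchanged ones, one is used by the base case; each
  -- of the other `k - 1` contributes a factor `1 + q`.
  have h := hasTranspositionElement (n := k + 2 * 1) ⟨k + 1, by omega⟩ rfl
    (k - 1) ⟨0, by omega⟩ (by simp only; omega)
  rw [show (⟨0, by omega⟩ : Fin (k + 2 * 1)) = lo ⟨0, by omega⟩ from rfl, klPoly_one_swap h]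
  simp [Finset.sum_range_succ]

/-! ### Growth -/

theorem coeff_le_maxCoeff (p : Polynomial ℤ) {d : ℕ} (hd : d ≤ p.natDegree) :
    p.coeff d ≤ maxCoeff p :=
  Finset.le_sup' p.coeff (Finset.mem_range.2 (Nat.lt_succ_of_le hd))

theorem eval_one_le_mul_maxCoeff (p : Polynomial ℤ) :
    p.eval 1 ≤ (p.natDegree + 1) * maxCoeff p := by
  rw [Polynomial.eval_eq_sum_range]
  simp only [one_pow, mul_one]
  calc ∑ d ∈ Finset.range (p.natDegree + 1), p.coeff d
      ≤ ∑ _d ∈ Finset.range (p.natDegree + 1), maxCoeff p :=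
        Finset.sum_le_sum fun d hd =>
          coeff_le_maxCoeff p (Nat.lt_succ_iff.1 (Finset.mem_range.1 hd))
    _ = (p.natDegree + 1) * maxCoeff p := by simp

theorem maxCoeff_le_coeffMax {n : ℕ} (w : Equiv.Perm (Fin n)) :
    maxCoeff (klPoly 1 w) ≤ coeffMax n :=
  Finset.le_sup' (fun w => maxCoeff (klPoly 1 w)) (Finset.mem_univ w)

theorem eval_one_le_evMax {n : ℕ} (w : Equiv.Perm (Fin n)) :
    (klPoly 1 w).eval 1 ≤ evMax n :=
  Finset.le_sup' (fun w => (klPoly 1 w).eval 1) (Finset.mem_univ w)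

theorem IsOmega.trans {f g h : ℕ → ℝ} (hf : IsOmega f g)
    (hg : ∃ C : ℝ, 0 < C ∧ ∃ n₀ : ℕ, ∀ n : ℕ, n₀ < n → C * h n ≤ g n) : IsOmega f h := by
  obtain ⟨C, hC, n₀, hf⟩ := hf
  obtain ⟨D, hD, n₁, hg⟩ := hg
  refine ⟨C * D, mul_pos hC hD, max n₀ n₁, fun n hn => ?_⟩
  rw [max_lt_iff] at hn
  rw [mul_assoc]
  exact (mul_le_mul_of_nonneg_left (hg n hn.2) hC.le).trans (hf n hn.1)

theorem IsOmega.of_le {f g : ℕ → ℝ} {C : ℝ} (hC : 0 < C) {n₀ : ℕ}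
    (h : ∀ n, n₀ < n → C * g n ≤ f n) : IsOmega f g :=
  ⟨C, hC, n₀, fun n hn => (h n hn).trans (le_abs_self _)⟩

/-! #### The product conjecture implies superexponential growth -/

theorem ProductFormula.pow_le_evMax {l : ℕ} (h : ProductFormula l) {k : ℕ} (hk : 1 ≤ k) :
    ((l : ℤ) + 1) ^ (k - 1) ≤ evMax (k + 2 * l) := by
  have := eval_one_le_evMax (wPerm k l)
  rw [h k hk] at this
  simpa [Polynomial.eval_finsetSum] using this

theorem natDegree_geom_pow_le (l k : ℕ) :
    ((∑ i ∈ Finset.range (l + 1), (Polynomial.X : Polynomial ℤ) ^ i) ^ k).natDegree ≤ k * l := by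
  refine Polynomial.natDegree_pow_le_of_le k (Polynomial.natDegree_sum_le_of_forall_le _ _ ?_)
  intro i hi
  rw [Polynomial.natDegree_X_pow]
  exact Nat.lt_succ_iff.1 (Finset.mem_range.1 hi)

theorem ProductFormula.pow_le_mul_coeffMax {l : ℕ} (h : ProductFormula l) {k : ℕ} (hk : 1 ≤ k) :
    ((l : ℤ) + 1) ^ (k - 1) ≤ (((k - 1) * l : ℕ) + 1) * coeffMax (k + 2 * l) := by
  have h₁ := eval_one_le_mul_maxCoeff (klPoly 1 (wPerm k l))
  have h₂ := maxCoeff_le_coeffMax (wPerm k l)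
  have h₃ : (klPoly 1 (wPerm k l)).natDegree ≤ (k - 1) * l := by
    rw [h k hk]
    exact natDegree_geom_pow_le l (k - 1)
  have h₄ : (klPoly 1 (wPerm k l)).eval 1 = ((l : ℤ) + 1) ^ (k - 1) := by
    rw [h k hk]
    simp [Polynomial.eval_finsetSum]
  rw [h₄] at h₁
  have hpos : 0 < ((l : ℤ) + 1) ^ (k - 1) := by positivity
  -- Enlarging the factor in front of `coeffMax` requires its nonnegativity, which holds because
  -- `P(1) > 0` rules out a negative largest coefficient.
  have hnn : 0 ≤ coeffMax (k + 2 * l) := by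
    refine le_trans ?_ h₂
    by_contra! hneg
    have : (((klPoly 1 (wPerm k l)).natDegree : ℤ) + 1) * maxCoeff (klPoly 1 (wPerm k l)) ≤ 0 :=
      mul_nonpos_of_nonneg_of_nonpos (by positivity) hneg.le
    omega
  refine h₁.trans ((mul_le_mul_of_nonneg_left h₂ (by positivity)).trans
    (mul_le_mul_of_nonneg_right ?_ hnn))
  exact_mod_cast Nat.succ_le_succ h₃

theorem ProductConjecture.superexponentialGrowth_evMax (h : ProductConjecture) :
    SuperexponentialGrowth evMax := by
  intro γ hγ
  obtain ⟨l, hl⟩ := exists_nat_ge γ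
  have hl₀ : (0 : ℝ) < (l : ℝ) + 1 := by positivity
  -- The exponent `2l + 1` is the difference between `n` and `k - 1`.
  refine IsOmega.of_le (C := (((l : ℝ) + 1) ^ (2 * l + 1))⁻¹) (by positivity) (n₀ := 2 * l)
    fun n hn => ?_
  obtain ⟨k, rfl⟩ : ∃ k, n = k + 1 + 2 * l := ⟨n - 2 * l - 1, by omega⟩
  have hle := (h l).pow_le_evMax (k := k + 1) (by omega)
  have hle' : ((l : ℝ) + 1) ^ k ≤ (evMax (k + 1 + 2 * l) : ℝ) := by exact_mod_cast hle
  refine le_trans ?_ hle'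
  rw [inv_mul_le_iff₀ (by positivity), ← pow_add]
  calc γ ^ (k + 1 + 2 * l) ≤ ((l : ℝ) + 1) ^ (k + 1 + 2 * l) :=
        pow_le_pow_left₀ (by linarith) (by linarith) _
    _ = ((l : ℝ) + 1) ^ (2 * l + 1 + k) := by ring_nf

theorem ProductConjecture.superexponentialGrowth_coeffMax (h : ProductConjecture) :
    SuperexponentialGrowth coeffMax := by
  intro γ hγ
  -- The factor `2` leaves a spare `2^n` to absorb the number of coefficients, which is linear in
  -- `k`.
  obtain ⟨l, hl⟩ := exists_nat_ge (2 * γ)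
  have hl₀ : (0 : ℝ) < (l : ℝ) + 1 := by positivity
  refine IsOmega.of_le (C := (((l : ℝ) + 1) ^ (2 * l + 2))⁻¹) (by positivity) (n₀ := 2 * l)
    fun n hn => ?_
  obtain ⟨k, rfl⟩ : ∃ k, n = k + 1 + 2 * l := ⟨n - 2 * l - 1, by omega⟩
  have hle := (h l).pow_le_mul_coeffMax (k := k + 1) (by omega)
  have hle' : ((l : ℝ) + 1) ^ k ≤ ((k : ℝ) * l + 1) * (coeffMax (k + 1 + 2 * l) : ℝ) := by
    exact_mod_cast hle
  have hk : (k : ℝ) + 1 ≤ 2 ^ k := by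
    exact_mod_cast Nat.succ_le_of_lt Nat.lt_two_pow_self
  have hc₀ : 0 ≤ (coeffMax (k + 1 + 2 * l) : ℝ) := by
    have h₁ : 0 ≤ ((k : ℝ) * l + 1) * (coeffMax (k + 1 + 2 * l) : ℝ) := le_trans (by positivity) hle'
    exact nonneg_of_mul_nonneg_right h₁ (by positivity)
  have hfac : (k : ℝ) * l + 1 ≤ ((l : ℝ) + 1) * 2 ^ (k + 1 + 2 * l) := by
    have h₂ : (2 : ℝ) ^ k ≤ 2 ^ (k + 1 + 2 * l) :=
      pow_le_pow_right₀ one_le_two (by omega)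
    calc (k : ℝ) * l + 1 ≤ (l + 1) * (k + 1) := by
          nlinarith [k.cast_nonneg (α := ℝ), l.cast_nonneg (α := ℝ)]
      _ ≤ ((l : ℝ) + 1) * 2 ^ (k + 1 + 2 * l) :=
        mul_le_mul_of_nonneg_left (hk.trans h₂) hl₀.le
  have hmain : ((l : ℝ) + 1) ^ k ≤
      ((l : ℝ) + 1) * 2 ^ (k + 1 + 2 * l) * (coeffMax (k + 1 + 2 * l) : ℝ) :=
    hle'.trans (mul_le_mul_of_nonneg_right hfac hc₀)
  rw [inv_mul_le_iff₀ (by positivity)]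
  have h2 : (0 : ℝ) < 2 ^ (k + 1 + 2 * l) := by positivity
  refine le_of_mul_le_mul_left ?_ h2
  calc (2 : ℝ) ^ (k + 1 + 2 * l) * γ ^ (k + 1 + 2 * l) = (2 * γ) ^ (k + 1 + 2 * l) :=
        (mul_pow _ _ _).symm
    _ ≤ ((l : ℝ) + 1) ^ (k + 1 + 2 * l) := pow_le_pow_left₀ (by linarith) (by linarith) _
    _ = ((l : ℝ) + 1) ^ (2 * l + 1) * ((l : ℝ) + 1) ^ k := by
        rw [← pow_add]
        ring_nf
    _ ≤ ((l : ℝ) + 1) ^ (2 * l + 1) *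
        (((l : ℝ) + 1) * 2 ^ (k + 1 + 2 * l) * (coeffMax (k + 1 + 2 * l) : ℝ)) :=
        mul_le_mul_of_nonneg_left hmain (by positivity)
    _ = _ := by ring

/-! #### Unconditional exponential growth -/

/-- The induction step amounts to `4(m+1)²(4m+1) ≤ (4m+5)(2m+1)²`, whose two sides differ by `1`. -/
theorem sixteen_pow_le_centralBinom_sq (m : ℕ) :
    16 ^ m ≤ (4 * m + 1) * m.centralBinom ^ 2 := by
  induction m with
  | zero => simp
  | succ m ih =>
    have hs := Nat.succ_mul_centralBinom_succ m
    have hpos : 0 < (m + 1) ^ 2 := by positivity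
    refine Nat.le_of_mul_le_mul_left ?_ hpos
    calc (m + 1) ^ 2 * 16 ^ (m + 1) = 16 * (m + 1) ^ 2 * 16 ^ m := by ring
      _ ≤ 16 * (m + 1) ^ 2 * ((4 * m + 1) * m.centralBinom ^ 2) := Nat.mul_le_mul_left _ ih
      _ = 16 * ((m + 1) ^ 2 * (4 * m + 1)) * m.centralBinom ^ 2 := by ring
      _ ≤ 4 * ((4 * (m + 1) + 1) * (2 * m + 1) ^ 2) * m.centralBinom ^ 2 := by
        refine Nat.mul_le_mul_right _ ?_
        nlinarith
      _ = (4 * (m + 1) + 1) * (2 * (2 * m + 1) * m.centralBinom) ^ 2 := by ring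
      _ = (4 * (m + 1) + 1) * ((m + 1) * (m + 1).centralBinom) ^ 2 := by rw [hs]
      _ = (m + 1) ^ 2 * ((4 * (m + 1) + 1) * (m + 1).centralBinom ^ 2) := by ring

theorem four_pow_le_sq_choose_half (r : ℕ) :
    4 ^ r ≤ 4 * ((2 * r + 1) * r.choose (r / 2) ^ 2) := by
  obtain ⟨m, rfl | rfl⟩ : ∃ m, r = 2 * m ∨ r = 2 * m + 1 := ⟨r / 2, by omega⟩
  · have h := sixteen_pow_le_centralBinom_sq m
    rw [Nat.centralBinom] at h
    have hd : 2 * m / 2 = m := by omega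
    have hp : 4 ^ (2 * m) = 16 ^ m := by
      rw [pow_mul]
      norm_num
    rw [hd, hp]
    nlinarith
  · have h := sixteen_pow_le_centralBinom_sq m
    rw [Nat.centralBinom] at h
    have hd : (2 * m + 1) / 2 = m := by omega
    have hp : 4 ^ (2 * m + 1) = 4 * 16 ^ m := by
      rw [pow_succ, pow_mul]
      ring
    have hc : (2 * m).choose m ≤ (2 * m + 1).choose m := Nat.choose_le_succ _ _
    have hc' : (2 * m).choose m ^ 2 ≤ (2 * m + 1).choose m ^ 2 := Nat.pow_le_pow_left hc 2
    rw [hd, hp]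
    refine Nat.mul_le_mul_left _ (h.trans (Nat.mul_le_mul ?_ hc'))
    omega

theorem choose_half_le_coeffMax (r : ℕ) : (r.choose (r / 2) : ℤ) ≤ coeffMax (r + 3) := by
  have h := productFormula_one (r + 1) (by omega)
  have hm := maxCoeff_le_coeffMax (wPerm (r + 1) 1)
  rw [h] at hm
  refine le_trans ?_ hm
  have hX : (∑ i ∈ Finset.range (1 + 1), (Polynomial.X : Polynomial ℤ) ^ i) =
      1 + Polynomial.X := by
    simp [Finset.sum_range_succ]
  rw [hX, Nat.add_sub_cancel, ← Polynomial.coeff_one_add_X_pow ℤ r (r / 2)]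
  refine coeff_le_maxCoeff _ (Polynomial.le_natDegree_of_ne_zero ?_)
  rw [Polynomial.coeff_one_add_X_pow]
  exact_mod_cast (Nat.choose_pos (Nat.div_le_self r 2)).ne'

theorem two_pow_le_evMax (r : ℕ) : (2 : ℤ) ^ r ≤ evMax (r + 3) := by
  have := productFormula_one.pow_le_evMax (k := r + 1) (by omega)
  simpa using this

theorem isOmega_coeffMax :
    IsOmega (fun n => (coeffMax n : ℝ)) (fun n => (n : ℝ) ^ (-(1 / 2) : ℝ) * 2 ^ n) := by
  -- With `n = r + 3`, the constant `1/32` turns `2^n` into `2^r / 4`; after squaring, the factor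
  -- `1/16` suffices against `four_pow_le_sq_choose_half`.
  refine IsOmega.of_le (C := 1 / 32) (by norm_num) (n₀ := 2) fun n hn => ?_
  obtain ⟨r, rfl⟩ : ∃ r, n = r + 3 := ⟨n - 3, by omega⟩
  have hc : (r.choose (r / 2) : ℝ) ≤ coeffMax (r + 3) := by
    exact_mod_cast choose_half_le_coeffMax r
  refine le_trans ?_ hc
  have hr : (0 : ℝ) < ((r + 3 : ℕ) : ℝ) := by positivity
  rw [Real.rpow_neg hr.le, ← Real.sqrt_eq_rpow, ← mul_assoc, mul_comm (1 / 32 : ℝ), mul_assoc,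
    inv_mul_le_iff₀ (Real.sqrt_pos.2 hr)]
  refine (pow_le_pow_iff_left₀ (by positivity) (by positivity) two_ne_zero).1 ?_
  rw [mul_pow (Real.sqrt _), Real.sq_sqrt hr.le]
  have h4 : (4 : ℝ) ^ r ≤ 4 * ((2 * r + 1) * (r.choose (r / 2) : ℝ) ^ 2) := by
    exact_mod_cast four_pow_le_sq_choose_half r
  have h5 : ((1 : ℝ) / 32 * 2 ^ (r + 3)) ^ 2 = 1 / 16 * 4 ^ r := by
    rw [pow_add, mul_pow, mul_pow, ← pow_mul, mul_comm r 2, pow_mul]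
    norm_num
    ring
  rw [h5]
  have hsq : (0 : ℝ) ≤ (r.choose (r / 2) : ℝ) ^ 2 := by positivity
  have hr₀ : (0 : ℝ) ≤ r := r.cast_nonneg
  push_cast
  nlinarith [mul_nonneg hr₀ hsq]

theorem isOmega_evMax_two_pow : IsOmega (fun n => (evMax n : ℝ)) (fun n => 2 ^ n) := by
  refine IsOmega.of_le (C := 1 / 8) (by norm_num) (n₀ := 2) fun n hn => ?_
  obtain ⟨r, rfl⟩ : ∃ r, n = r + 3 := ⟨n - 3, by omega⟩
  have h : (2 : ℝ) ^ r ≤ evMax (r + 3) := by exact_mod_cast two_pow_le_evMax r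
  refine le_trans (le_of_eq ?_) h
  rw [pow_add]
  ring

theorem isOmega_evMax :
    IsOmega (fun n => (evMax n : ℝ)) (fun n => (n : ℝ) ^ (-(1 / 2) : ℝ) * 2 ^ n) := by
  refine isOmega_evMax_two_pow.trans ⟨1, one_pos, 0, fun n hn => ?_⟩
  rw [one_mul]
  refine mul_le_of_le_one_left (by positivity) ?_
  exact Real.rpow_le_one_of_one_le_of_nonpos (by exact_mod_cast hn) (by norm_num)

theorem exists_pow_le_rpow_mul_two_pow :
    ∃ C : ℝ, 0 < C ∧ ∃ n₀ : ℕ, ∀ n : ℕ, n₀ < n →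
      C * (3 / 2 : ℝ) ^ n ≤ (n : ℝ) ^ (-(1 / 2) : ℝ) * 2 ^ n := by
  -- Since `2 = (4/3)(3/2)`, Bernoulli's inequality `(4/3)^n ≥ 1 + n/3` absorbs `√n / 3`.
  refine ⟨1 / 3, by norm_num, 0, fun n hn => ?_⟩
  have hn₁ : (1 : ℝ) ≤ n := by exact_mod_cast hn
  have hn₀ : (0 : ℝ) < n := by linarith
  rw [Real.rpow_neg hn₀.le, ← Real.sqrt_eq_rpow, le_inv_mul_iff₀ (Real.sqrt_pos.2 hn₀)]
  have hsqrt : √(n : ℝ) ≤ n := Real.sqrt_le_iff.2 ⟨hn₀.le, by nlinarith⟩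
  have hb : 1 + (n : ℝ) * (1 / 3) ≤ (1 + 1 / 3) ^ n :=
    one_add_mul_le_pow (by norm_num) n
  have h3 : (0 : ℝ) < (3 / 2) ^ n := by positivity
  calc √(n : ℝ) * (1 / 3 * (3 / 2) ^ n) = √(n : ℝ) * (1 / 3) * (3 / 2) ^ n := by ring
    _ ≤ (1 + 1 / 3) ^ n * (3 / 2) ^ n := mul_le_mul_of_nonneg_right (by linarith) h3.le
    _ = 2 ^ n := by
      rw [← mul_pow]
      norm_num

end

end KLGrowth

theorem mainTheorem1 :
    -- the product conjecture implies superexponential growth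
    (KLGrowth.ProductConjecture →
      KLGrowth.SuperexponentialGrowth KLGrowth.coeffMax ∧
      KLGrowth.SuperexponentialGrowth KLGrowth.evMax) ∧
    -- the product conjecture holds for `l = 0` and `l = 1`
    KLGrowth.ProductFormula 0 ∧
    KLGrowth.ProductFormula 1 ∧
    -- at least exponential growth, with an explicit rate
    KLGrowth.IsOmega (fun n => (KLGrowth.coeffMax n : ℝ))
      (fun n => (n : ℝ) ^ (-(1 / 2) : ℝ) * 2 ^ n) ∧
    KLGrowth.IsOmega (fun n => (KLGrowth.evMax n : ℝ))
      (fun n => (n : ℝ) ^ (-(1 / 2) : ℝ) * 2 ^ n) ∧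
    (∃ γ : ℝ, 1 < γ ∧ KLGrowth.IsOmega (fun n => (KLGrowth.coeffMax n : ℝ)) (fun n => γ ^ n)) ∧
    (∃ γ : ℝ, 1 < γ ∧ KLGrowth.IsOmega (fun n => (KLGrowth.evMax n : ℝ)) (fun n => γ ^ n)) := by
  have hcoeff := KLGrowth.isOmega_coeffMax
  have hev := KLGrowth.isOmega_evMax
  have hγ : (1 : ℝ) < 3 / 2 := by norm_num
  exact ⟨fun h => ⟨h.superexponentialGrowth_coeffMax, h.superexponentialGrowth_evMax⟩,
    KLGrowth.productFormula_zero, KLGrowth.productFormula_one, hcoeff, hev,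
    ⟨3 / 2, hγ, hcoeff.trans KLGrowth.exists_pow_le_rpow_mul_two_pow⟩,
    ⟨3 / 2, hγ, hev.trans KLGrowth.exists_pow_le_rpow_mul_two_pow⟩⟩
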